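/- Let $k$ be a field, $n\ge 1$ an integer, and let $\mathcal C$ be a $k$-linear, Hom-finite additive category with split idempotents which is $(n+2)$-angulated (in the sense of Geiss–Keller–Oppermann) with $k$-linear $n$-suspension functor $\Sigma^n$. Assume that $\mathcal C$ is $2n$-Calabi–Yau, i.e. $\mathcal C(X,\Sigma^nY)\cong D\,\mathcal C(Y,\Sigma^nX)$ naturally in $X,Y\in\mathcal C$, where $D=\operatorname{Hom}_k(-,k)$. Let $T$ be an Oppermann–Thomas cluster tilting object of $\mathcal C$: $\mathcal C(T,\Sigma^nT)=0$, and for every $X\in\mathcal C$ there is an $(n+2)$-angle $T_0\to T_1\to\cdots\to T_n\to X\to\Sigma^nT_0$ with all $T_i\in\operatorname{add}T$. Put $\Lambda=\operatorname{End}_{\mathcal C}(T)$, let $\operatorname{mod}\Lambda$ be the category of finite-dimensional right $\Lambda$-modules, let $\mathcal D\subseteq\operatorname{mod}\Lambda$ be the essential image of $\mathcal C(T,-)\colon\mathcal C\to\operatorname{mod}\Lambda$, and let $\tau_n=\tau\,\Omega^{n-1}$ be the $n$-Auslander–Reiten translation, where $\tau$ is the Auslander–Reiten translation and $\Omega$ the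 syzygy with respect to projective covers. An object $X\in\mathcal C$ is - *$n$-rigid* if $\mathcal C(X,\Sigma^nX)=0$; - *maximal $n$-rigid* if it is $n$-rigid and $\operatorname{add}X=\{M\in\mathcal C\mid \mathcal C(X\oplus M,\Sigma^n(X\oplus M))=0\}$; - *$n$-self-perpendicular* if $\operatorname{add}X=\{M\in\mathcal C\mid\mathcal C(X,\Sigma^nM)=0\}=\{M\in\mathcal C\mid\mathcal C(M,\Sigma^nX)=0\}$. A pair $(M,P)$ with $M\in\mathcal D$ and $P$ a finitely generated projective $\Lambda$-module is - a *$\tau_n$-rigid pair* if $\operatorname{Hom}_\Lambda(M,\tau_nM)=0$ and $\operatorname{Hom}_\Lambda(P,M)=0$; - a *support $\tau_n$-tilting pair* if it is a $\tau_n$-rigid pair, every $N\in\mathcal D$ such that $(M\oplus N,P)$ is a $\tau_n$-rigid pair lies in $\operatorname{add}M$, and a finitely generated projective $\Lambda$-module $Q$ lies in $\operatorname{add}P$ if and only if $\operatorname{Hom}_\Lambda(Q,M)=0$; - a *maximal $\tau_n$-rigid pair* if an object $N\in\mathcal D$ lies in $\operatorname{add}M$ if and only if $\operatorname{Hom}_\Lambda(M,\tau_nN)=0$,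 $\operatorname{Hom}_\Lambda(N,\tau_nM)=0$ and $\operatorname{Hom}_\Lambda(P,N)=0$, and a finitely generated projective $\Lambda$-module $Q$ lies in $\operatorname{add}P$ if and only if $\operatorname{Hom}_\Lambda(Q,M)=0$. Then there is a map $F$ from isomorphism classes of objects of $\mathcal C$ to isomorphism classes of pairs of finite-dimensional $\Lambda$-modules such that $$F\big(M_0\oplus\Sigma^nT'\big)=\big(\mathcal C(T,M_0),\ \mathcal C(T,T')\big)$$ whenever $T'\in\operatorname{add}T$ and $M_0$ has no non-zero direct summand in $\operatorname{add}\Sigma^nT$, and $F$ restricts to a bijection from the set of isomorphism classes of $n$-rigid objects of $\mathcal C$ to the set of isomorphism classes of $\tau_n$-rigid pairs, to a bijection from the set of isomorphism classes of maximal $n$-rigid objects to the set of isomorphism classes of support $\tau_n$-tilting pairs, and to a bijection from the set of isomorphism classes of $n$-self-perpendicular objects to the set of isomorphism classes of maximal $\tau_n$-rigid pairs. -/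

import Mathlib

open CategoryTheory CategoryTheory.Limits

universe w v u

attribute [local instance] hasBinaryBiproducts_of_finite_biproducts

noncomputable section

/-! ### Sequences and `(n+2)`-angulations (Geiss, Keller and Oppermann) -/

namespace HigherAngulated

variable {C : Type u} [Category.{v} C]

/-- A sequence `A_0 ⟶ A_1 ⟶ ⋯ ⟶ A_{n+1} ⟶ S A_0` of morphisms of `C`; no condition is imposed
on composites. -/
structure AngleSeq (S : C ⥤ C) (n : ℕ) where
  obj : Fin (n + 2) → C
  map : ∀ i : Fin (n + 1), obj i.castSucc ⟶ obj i.succ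
  last : obj (Fin.last (n + 1)) ⟶ S.obj (obj 0)

namespace AngleSeq

variable {S : C ⥤ C} {n : ℕ}

/-- A morphism of sequences: every square commutes, the last one having `S φ_0` as its right-hand
side. -/
structure Hom (A B : AngleSeq S n) where
  app : ∀ i : Fin (n + 2), A.obj i ⟶ B.obj i
  comm : ∀ i : Fin (n + 1), A.map i ≫ app i.succ = app i.castSucc ≫ B.map i
  comm_last : A.last ≫ S.map (app 0) = app (Fin.last (n + 1)) ≫ B.last

variable [Preadditive C] [HasFiniteBiproducts C]

/-- The direct sum of two sequences. -/
def sum (A B : AngleSeq S n) : AngleSeq S n where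
  obj i := A.obj i ⊞ B.obj i
  map i := biprod.map (A.map i) (B.map i)
  last := biprod.desc (A.last ≫ S.map biprod.inl) (B.last ≫ S.map biprod.inr)

/-- `B` is (isomorphic to) the left rotation
`A_1 ⟶ A_2 ⟶ ⋯ ⟶ A_{n+1} ⟶ S A_0 ⟶ S A_1` of `A`, whose last morphism is `(-1)^n S α_0`. -/
def IsLeftRotation (A B : AngleSeq S n) : Prop :=
  ∃ (e : ∀ i : Fin (n + 1), B.obj i.castSucc ≅ A.obj i.succ)
    (e' : B.obj (Fin.last (n + 1)) ≅ S.obj (A.obj 0)),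
    (∀ i : Fin n, B.map i.castSucc ≫ (e i.succ).hom = (e i.castSucc).hom ≫ A.map i.succ) ∧
    B.map (Fin.last n) ≫ e'.hom = (e (Fin.last n)).hom ≫ A.last ∧
    B.last ≫ S.map (e 0).hom = e'.hom ≫ ((-1 : ℤ) ^ n • S.map (A.map 0))

/-- The morphism `X₁ ⊞ X₂ ⟶ Y₁ ⊞ Y₂` with matrix `[[-a, 0], [p, b]]`. -/
def coneMap {X₁ X₂ Y₁ Y₂ : C} (a : X₁ ⟶ Y₁) (p : X₁ ⟶ Y₂) (b : X₂ ⟶ Y₂) :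
    X₁ ⊞ X₂ ⟶ Y₁ ⊞ Y₂ :=
  biprod.desc (biprod.lift (-a) p) (biprod.lift 0 b)

/-- `E` is (isomorphic to) the mapping cone
`A_1 ⊞ B_0 ⟶ A_2 ⊞ B_1 ⟶ ⋯ ⟶ A_{n+1} ⊞ B_n ⟶ S A_0 ⊞ B_{n+1} ⟶ S (A_1 ⊞ B_0)` of `φ : A ⟶ B`. -/
def Hom.IsCone {A B : AngleSeq S n} (φ : Hom A B) (E : AngleSeq S n) : Prop :=
  ∃ (e : ∀ i : Fin (n + 1), E.obj i.castSucc ≅ A.obj i.succ ⊞ B.obj i.castSucc)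
    (e' : E.obj (Fin.last (n + 1)) ≅ S.obj (A.obj 0) ⊞ B.obj (Fin.last (n + 1))),
    (∀ i : Fin n, E.map i.castSucc ≫ (e i.succ).hom =
      (e i.castSucc).hom ≫ coneMap (A.map i.succ) (φ.app i.castSucc.succ) (B.map i.castSucc)) ∧
    E.map (Fin.last n) ≫ e'.hom =
      (e (Fin.last n)).hom ≫ coneMap A.last (φ.app (Fin.last (n + 1))) (B.map (Fin.last n)) ∧
    E.last ≫ S.map (e 0).hom =
      e'.hom ≫ biprod.desc
        (S.map (biprod.lift (-A.map 0) (φ.app (Fin.castSucc 0))))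
        (B.last ≫ S.map biprod.inr)

end AngleSeq

variable [Preadditive C] [HasFiniteBiproducts C]

/-- An `(n+2)`-angulation of the additive category `C` with suspension `S` (axioms (F1) to (F4) of
Geiss, Keller and Oppermann): a class of sequences, the `(n+2)`-angles. -/
structure Angulation (S : C ⥤ C) (n : ℕ) where
  IsAngle : AngleSeq S n → Prop
  /-- (F1)(a): closed under isomorphisms, ... -/
  of_iso : ∀ {A B : AngleSeq S n} (φ : AngleSeq.Hom A B), (∀ i, IsIso (φ.app i)) →
    IsAngle A → IsAngle B
  /-- ... under direct sums and under direct summands. -/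
  sum_iff : ∀ A B : AngleSeq S n, IsAngle (A.sum B) ↔ IsAngle A ∧ IsAngle B
  /-- (F1)(b): the sequences `A = A ⟶ 0 ⟶ ⋯ ⟶ 0 ⟶ S A` are angles (stated up to isomorphism). -/
  trivial : ∀ A : AngleSeq S n, IsIso (A.map 0) →
    (∀ i : Fin (n + 2), 2 ≤ i.val → IsZero (A.obj i)) → IsAngle A
  /-- (F1)(c): every morphism is the first morphism of an angle. -/
  exists_angle : ∀ {X Y : C} (f : X ⟶ Y), ∃ A : AngleSeq S n, IsAngle A ∧
    ∃ (e₀ : A.obj (Fin.castSucc 0) ≅ X) (e₁ : A.obj (Fin.succ 0) ≅ Y),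
      A.map 0 ≫ e₁.hom = e₀.hom ≫ f
  /-- (F2): rotation. -/
  rotate_iff : ∀ A B : AngleSeq S n, A.IsLeftRotation B → (IsAngle A ↔ IsAngle B)
  /-- (F3) and (F4): a commutative first square extends to a morphism of angles, and the extension
  can be chosen so that its mapping cone is an angle. -/
  complete : ∀ A B : AngleSeq S n, IsAngle A → IsAngle B →
    ∀ (f₀ : A.obj (Fin.castSucc 0) ⟶ B.obj (Fin.castSucc 0))
      (f₁ : A.obj (Fin.succ 0) ⟶ B.obj (Fin.succ 0)),
      A.map 0 ≫ f₁ = f₀ ≫ B.map 0 →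
      ∃ φ : AngleSeq.Hom A B, φ.app (Fin.castSucc 0) = f₀ ∧ φ.app (Fin.succ 0) = f₁ ∧
        ∃ E : AngleSeq S n, φ.IsCone E ∧ IsAngle E

/-! ### Objects of an `(n+2)`-angulated category -/

/-- `X` is a direct summand of `Z`. -/
def IsSummand (X Z : C) : Prop := ∃ Y : C, Nonempty (X ⊞ Y ≅ Z)

/-- `add M`: the direct summands of finite direct sums of copies of `M`. -/
def add (M : C) : ObjectProperty C := fun X => ∃ m : ℕ, IsSummand X (⨁ fun _ : Fin m => M)

/-- `C(X, Y) = 0`. -/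
def HomZero (X Y : C) : Prop := ∀ f : X ⟶ Y, f = 0

/-- Oppermann--Thomas cluster tilting objects. -/
def IsClusterTilting {S : C ⥤ C} {n : ℕ} (𝒜 : Angulation S n) (T : C) : Prop :=
  HomZero T (S.obj T) ∧
  ∀ X : C, ∃ A : AngleSeq S n, 𝒜.IsAngle A ∧ (∀ i : Fin (n + 1), add T (A.obj i.castSucc)) ∧
    Nonempty (A.obj (Fin.last (n + 1)) ≅ X)

/-- `n`-rigid objects (`S` is the `n`-suspension). -/
def IsRigid (S : C ⥤ C) : ObjectProperty C := fun X => HomZero X (S.obj X)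

/-- Maximal `n`-rigid objects. -/
def IsMaximalRigid (S : C ⥤ C) : ObjectProperty C := fun X =>
  IsRigid S X ∧ ∀ M : C, add X M ↔ HomZero (X ⊞ M) (S.obj (X ⊞ M))

/-- `n`-self-perpendicular objects. -/
def IsSelfPerpendicular (S : C ⥤ C) : ObjectProperty C := fun X =>
  (∀ M : C, add X M ↔ HomZero X (S.obj M)) ∧ (∀ M : C, add X M ↔ HomZero M (S.obj X))

/-- `X` has no non-zero direct summand in `add Y`. -/
def HasNoSummandInAdd (X Y : C) : Prop := ∀ Z : C, IsSummand Z X → add Y Z → IsZero Z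

/-- The `2n`-Calabi--Yau property: isomorphisms `C(X, S Y) ≃ D C(Y, S X)`, `D = Hom_k(-, k)`,
natural in `X` and `Y`. -/
def IsCalabiYau (k : Type w) [Field k] [Linear k C] (S : C ⥤ C) : Prop :=
  ∃ e : ∀ X Y : C, (X ⟶ S.obj Y) ≃ₗ[k] Module.Dual k (Y ⟶ S.obj X),
    ∀ (X X' Y Y' : C) (f : X' ⟶ X) (g : Y ⟶ Y') (p : X ⟶ S.obj Y) (q : Y' ⟶ S.obj X'),
      e X' Y' (f ≫ p ≫ S.map g) q = e X Y p (g ≫ q ≫ S.map f)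

end HigherAngulated

/-! ### The `n`-Auslander--Reiten translation over a finite-dimensional algebra

Left modules over `R` are used throughout; in the application `R` is the opposite of the
endomorphism algebra, so that these are its right modules. -/

namespace HigherAR

/-- A projective cover of `M`: a surjection onto `M` with superfluous kernel from a finitely
generated projective module. -/
structure ProjectiveCover (R : Type v) [Ring R] (M : Type v) [AddCommGroup M] [Module R M] where
  P : FGModuleCat.{v} R
  projective : Module.Projective R P
  π : P →ₗ[R] M
  surjective : Function.Surjective π
  superfluous : ∀ N : Submodule R P, N ⊔ LinearMap.ker π = ⊤ → N = ⊤

theorem ProjectiveCover.nonempty (R : Type v) [Ring R] [IsArtinianRing R] [IsNoetherianRing R]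
    (M : Type v) [AddCommGroup M] [Module R M] [Module.Finite R M] :
    Nonempty (ProjectiveCover R M) := by
  classical
  -- a surjection from a finitely generated projective module of minimal length
  let p : ℕ → Prop := fun l => ∃ (P : FGModuleCat.{v} R) (π : P →ₗ[R] M),
    Module.Projective R P ∧ Function.Surjective π ∧ Module.length R P = l
  have hfin : ∀ P : FGModuleCat.{v} R, Module.length R P ≠ ⊤ := fun P => Module.length_ne_top
  have hex : ∃ l, p l := by
    obtain ⟨m, f, hf⟩ := Module.Finite.exists_fin' R M
    refine ⟨(Module.length R (Fin m → R)).toNat, FGModuleCat.of R (Fin m → R), f,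
      inferInstanceAs (Module.Projective R (Fin m → R)), hf, ?_⟩
    exact (ENat.natCast_toNat (hfin (FGModuleCat.of R (Fin m → R)))).symm
  obtain ⟨P, π, hP, hπ, hl⟩ := Nat.find_spec hex
  refine ⟨⟨P, hP, π, hπ, fun N hN => ?_⟩⟩
  by_contra hne
  -- lift `π` through its restriction to `N`
  have hsurj : Function.Surjective (π ∘ₗ N.subtype) := by
    rw [← LinearMap.range_eq_top, LinearMap.range_comp, Submodule.range_subtype]
    have h1 := congrArg (Submodule.map π) hN
    rw [Submodule.map_sup, Submodule.map_top, LinearMap.range_eq_top.2 hπ] at h1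
    have h2 : Submodule.map π (LinearMap.ker π) = ⊥ := by
      rw [eq_bot_iff]
      rintro _ ⟨x, hx, rfl⟩
      exact hx
    rwa [h2, sup_bot_eq] at h1
  obtain ⟨g, hg⟩ := Module.projective_lifting_property (π ∘ₗ N.subtype) π hsurj
  let e : Module.End R P := N.subtype ∘ₗ g
  have he : ∀ x, π (e x) = π x := fun x => LinearMap.congr_fun hg x
  have hem : ∀ (m : ℕ) (x), π ((e ^ m) x) = π x := by
    intro m
    induction m with
    | zero => intro x; rfl
    | succ m ih => intro x; rw [pow_succ, Module.End.mul_apply, ih, he]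
  obtain ⟨m, hm, hm1⟩ := (e.eventually_isCompl_ker_pow_range_pow.and
    (Filter.eventually_ge_atTop 1)).exists
  let Q : Submodule R P := LinearMap.range (e ^ m)
  have hQN : Q ≤ N := by
    rintro _ ⟨x, rfl⟩
    obtain ⟨j, rfl⟩ : ∃ j, m = j + 1 := ⟨m - 1, by omega⟩
    rw [pow_succ', Module.End.mul_apply]
    exact (g _).2
  have hQ : Q ≠ ⊤ := fun h => hne (top_le_iff.1 (h ▸ hQN))
  have hproj : Module.Projective R Q := by
    refine Module.Projective.of_split Q.subtype (Q.projectionOnto _ hm.symm) ?_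
    ext x
    simp
  have hlt : Module.length R Q < Module.length R P := Submodule.length_lt hQ
  have hmin := Nat.find_min' hex (m := (Module.length R Q).toNat)
    ⟨FGModuleCat.of R Q, π ∘ₗ Q.subtype, hproj, fun y => by
      obtain ⟨x, rfl⟩ := hπ y
      exact ⟨⟨(e ^ m) x, x, rfl⟩, hem m x⟩,
      (ENat.natCast_toNat (hfin (FGModuleCat.of R Q))).symm⟩
  have h3 : (((Module.length R Q).toNat : ℕ) : ℕ∞) = Module.length R Q :=
    ENat.natCast_toNat (hfin (FGModuleCat.of R Q))
  rw [hl, ← h3] at hlt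
  exact absurd hmin (not_le.2 (by exact_mod_cast hlt))

variable (k : Type w) [Field k] {R : Type v} [Ring R] [Algebra k R] [Module.Finite k R]

/-- A (chosen) projective cover of a finitely generated module over a finite-dimensional
`k`-algebra. -/
def cover (M : FGModuleCat.{v} R) : ProjectiveCover R M :=
  haveI : IsArtinianRing R := IsArtinianRing.of_finite k R
  haveI : IsNoetherianRing R := IsNoetherianRing.of_finite k R
  (ProjectiveCover.nonempty R M).some

/-- The syzygy `Ω M`: the kernel of the projective cover of `M`. -/
def syzygy (M : FGModuleCat.{v} R) : FGModuleCat.{v} R :=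
  haveI : IsNoetherianRing R := IsNoetherianRing.of_finite k R
  FGModuleCat.of R (LinearMap.ker (cover k M).π)

/-- `P_1 ⟶ P_0`, the differential of the minimal projective presentation of `M`. -/
def presentation (M : FGModuleCat.{v} R) : (cover k (syzygy k M)).P →ₗ[R] (cover k M).P :=
  (LinearMap.ker (cover k M).π).subtype ∘ₗ (cover k (syzygy k M)).π

/-- The Nakayama functor `D Hom_R(-, R)` on objects, with `D = Hom_k(-, k)`. -/
def Nakayama (k : Type w) [Field k] (R : Type v) [Ring R] [Algebra k R]
    (P : Type v) [AddCommGroup P] [Module R P] : Type (max v w) :=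
  (P →ₗ[R] R) →ₗ[k] k

namespace Nakayama

variable (P : Type v) [AddCommGroup P] [Module R P]

instance : AddCommGroup (Nakayama k R P) :=
  inferInstanceAs (AddCommGroup ((P →ₗ[R] R) →ₗ[k] k))

/-- Right multiplication by `r` on `Hom_R(P, R)`, that is `f ↦ (p ↦ f p * r)`. -/
def mulRight (r : R) : (P →ₗ[R] R) →ₗ[k] (P →ₗ[R] R) where
  toFun f := LinearMap.toSpanSingleton R R r ∘ₗ f
  map_add' f g := by ext p; simp [add_mul]
  map_smul' c f := by ext p; simp

/-- `(r φ)(f) = φ(f r)`. -/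
instance : Module R (Nakayama k R P) where
  smul r φ := LinearMap.comp φ (mulRight k P r)
  one_smul φ := by
    refine LinearMap.ext fun f => congrArg (DFunLike.coe (F := (P →ₗ[R] R) →ₗ[k] k) φ) ?_
    ext p; simp [mulRight]
  mul_smul r s φ := by
    refine LinearMap.ext fun f => congrArg (DFunLike.coe (F := (P →ₗ[R] R) →ₗ[k] k) φ) ?_
    ext p; simp [mulRight, mul_assoc]
  smul_zero r := rfl
  smul_add r φ ψ := rfl
  add_smul r s φ := by
    refine LinearMap.ext fun f => Eq.trans (congrArg
      (DFunLike.coe (F := (P →ₗ[R] R) →ₗ[k] k) φ) (?_ : _ = mulRight k P r f + mulRight k P s f))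
      (LinearMap.map_add (φ : (P →ₗ[R] R) →ₗ[k] k) _ _)
    ext p; simp [mulRight, mul_add]
  zero_smul φ := by
    refine LinearMap.ext fun f => Eq.trans (congrArg
      (DFunLike.coe (F := (P →ₗ[R] R) →ₗ[k] k) φ) (?_ : mulRight k P 0 f = 0))
      (LinearMap.map_zero (φ : (P →ₗ[R] R) →ₗ[k] k))
    ext p; simp [mulRight]

variable {P} {Q : Type v} [AddCommGroup Q] [Module R Q]

/-- The Nakayama functor on morphisms: `φ ↦ (f ↦ φ (f ∘ g))`. -/
def map (g : P →ₗ[R] Q) : Nakayama k R P →ₗ[R] Nakayama k R Q where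
  toFun φ := LinearMap.comp φ (LinearMap.lcomp k R g)
  map_add' _ _ := rfl
  map_smul' _ _ := rfl

end Nakayama

/-- The Auslander--Reiten translation `τ M = ker (D Hom(P_1, R) ⟶ D Hom(P_0, R))`, where
`P_1 ⟶ P_0 ⟶ M ⟶ 0` is the minimal projective presentation. -/
abbrev tau (M : FGModuleCat.{v} R) : Type (max v w) :=
  LinearMap.ker (Nakayama.map k (presentation k M))

/-- The `n`-Auslander--Reiten translation `τ_n = τ Ω^{n-1}`. With `P_• ⟶ M` the minimal projective
resolution, `τ_n M = ker (D Hom(P_n, R) ⟶ D Hom(P_{n-1}, R))`. -/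
abbrev tauN (n : ℕ) (M : FGModuleCat.{v} R) : Type (max v w) :=
  tau k ((syzygy k)^[n - 1] M)

/-- `Hom_R(M, τ_n N) = 0`. -/
def HomTauZero (n : ℕ) (M N : FGModuleCat.{v} R) : Prop :=
  ∀ f : M →ₗ[R] tauN k n N, f = 0

/-- `Hom_R(M, N) = 0`. -/
def ModHomZero (M N : FGModuleCat.{v} R) : Prop := ∀ f : M →ₗ[R] N, f = 0

/-- `add M` in the category of finitely generated modules. -/
def addMod (M : FGModuleCat.{v} R) : ObjectProperty (FGModuleCat.{v} R) := fun N =>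
  ∃ (m : ℕ) (Y : FGModuleCat.{v} R), Nonempty ((N × Y) ≃ₗ[R] (Fin m → M))

/-! ### Pairs `(M, P)` with `M` in a subcategory `𝒟` of `mod R` and `P` in `proj R` -/

/-- `τ_n`-rigid pairs. -/
def IsTauRigidPair (n : ℕ) (𝒟 : ObjectProperty (FGModuleCat.{v} R)) :
    ObjectProperty (FGModuleCat.{v} R × FGModuleCat.{v} R) := fun p =>
  (𝒟 p.1 ∧ Module.Projective R p.2) ∧ HomTauZero k n p.1 p.1 ∧ ModHomZero p.2 p.1

/-- Support `τ_n`-tilting pairs. -/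
def IsSupportTauTiltingPair (n : ℕ) (𝒟 : ObjectProperty (FGModuleCat.{v} R)) :
    ObjectProperty (FGModuleCat.{v} R × FGModuleCat.{v} R) := fun p =>
  IsTauRigidPair k n 𝒟 p ∧
  (∀ N, 𝒟 N → IsTauRigidPair k n 𝒟 (FGModuleCat.of R (p.1 × N), p.2) → addMod p.1 N) ∧
  (∀ Q : FGModuleCat.{v} R, Module.Projective R Q → (addMod p.2 Q ↔ ModHomZero Q p.1))

/-- Maximal `τ_n`-rigid pairs. -/
def IsMaximalTauRigidPair (n : ℕ) (𝒟 : ObjectProperty (FGModuleCat.{v} R)) :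
    ObjectProperty (FGModuleCat.{v} R × FGModuleCat.{v} R) := fun p =>
  (𝒟 p.1 ∧ Module.Projective R p.2) ∧
  (∀ N, 𝒟 N → (addMod p.1 N ↔
    HomTauZero k n p.1 N ∧ HomTauZero k n N p.1 ∧ ModHomZero p.2 N)) ∧
  (∀ Q : FGModuleCat.{v} R, Module.Projective R Q → (addMod p.2 Q ↔ ModHomZero Q p.1))

end HigherAR

namespace HigherAngulated

variable {C : Type u} [Category.{v} C] [Preadditive C]

theorem finite_hom (k : Type w) [Field k] [Linear k C] [∀ X Y : C, Module.Finite k (X ⟶ Y)]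
    (T X : C) : ModuleCat.isFG (End T)ᵐᵒᵖ ((preadditiveCoyonedaObj T).obj X) := by
  change Module.Finite (End T)ᵐᵒᵖ (T ⟶ X)
  have : IsScalarTower k (End T)ᵐᵒᵖ (T ⟶ X) :=
    ⟨fun c f g => Linear.smul_comp T T X c f.unop g⟩
  exact Module.Finite.of_restrictScalars_finite k (End T)ᵐᵒᵖ (T ⟶ X)

/-- For a Hom-finite category, `C(T, -) : C ⥤ mod (End T)`, the target being the category of
finitely generated right `End T`-modules. -/
def homFunctor (k : Type w) [Field k] [Linear k C] [∀ X Y : C, Module.Finite k (X ⟶ Y)] (T : C) :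
    C ⥤ FGModuleCat.{v} (End T)ᵐᵒᵖ :=
  (ModuleCat.isFG (End T)ᵐᵒᵖ).lift (preadditiveCoyonedaObj T) (finite_hom k T)

instance (k : Type w) [Field k] [Linear k C] [∀ X Y : C, Module.Finite k (X ⟶ Y)] (T : C) :
    Module.Finite k (End T) :=
  inferInstanceAs (Module.Finite k (T ⟶ T))

/-- The isomorphism class of an object. -/
def isoClass {A : Type*} [Category* A] (X : A) : Quotient (isIsomorphicSetoid A) :=
  Quotient.mk (isIsomorphicSetoid A) X

/-- The set of isomorphism classes of the objects with a given property. -/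
def isoClasses {A : Type*} [Category* A] (P : ObjectProperty A) :
    Set (Quotient (isIsomorphicSetoid A)) :=
  {c | ∃ X, P X ∧ isoClass X = c}

end HigherAngulated

end

/-! Write `S` for the `n`-suspension and `G` for `C(T, -)`. By a Fitting argument every object
splits as `M ⊞ S U` with `U` in `add T` and `M` without non-zero summand in `add (S T)`, and both
parts are unique up to isomorphism. `G` kills `add (S T)`, identifies `add T` with the finitely
generated projectives, and is full, because the angle ending in `X` provides a projective
presentation of `G X`. A morphism killed by `G` factors through `add (S T)`; for an endomorphism of
`M` this makes it radical, so `G M` determines `M`. Hence `M ⊞ S U ↦ (G M, G U)` is well defined and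
injective on isomorphism classes and reaches all pairs whose first entry is in the image of `G` and
whose second is projective. Each of the three bijections then reduces to translating two things into
module terms: vanishing of `C(X, S Y)` (`homZero_biprod_iff`) and membership in `add X`
(`add_biprod_iff`).

The core is the vanishing of `C(M, S N)` for the parts without summands in `add (S T)`. First,
`Hom(M, τ_n N) = 0` if and only if `Ext^n(N, X) = 0` for every quotient `X` of `M`
(`homTauZero_iff`); this criterion mentions no chosen resolution. Secondly, `G` turns the angle `T_0
⟶ ⋯ ⟶ T_n ⟶ N ⟶ S T_0` into the start of a projective resolution of `G N`. Its leftmost map has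
superfluous kernel because `N` has no summand in `add (S T)` (`superfluous_ker_homMap`). So `Ext^n`
may be read off from the angle, and `Hom(G M, τ_n G N) = 0` says exactly that all composites `N ⟶ S
U ⟶ S M` with `U` in `add T` vanish (`homTauZero_homObj_iff`).

Finally, by Calabi–Yau duality, if such composites `N ⟶ S U ⟶ S M` vanish, then every `M ⟶ S N`
factors through `add (S T)`; if the composites `M ⟶ S U ⟶ S N` vanish as well, then `C(M, S N) = 0`
(`homZero_iff_homTauZero`). -/

noncomputable section

namespace HigherAR

/-! ### Vanishing of extensions over a ring -/

section Ext

variable {R : Type v} [Ring R] {K P L : Type v} [AddCommGroup K] [Module R K] [AddCommGroup P]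
  [Module R P] [AddCommGroup L] [Module R L]

open CategoryTheory.Abelian

/-- `Ext^j_R(L, X) = 0`. -/
def ExtZero (R : Type v) [Ring R] (j : ℕ) (L : Type v) [AddCommGroup L] [Module R L]
    (X : Type v) [AddCommGroup X] [Module R X] : Prop :=
  Subsingleton (Ext.{v} (ModuleCat.of R L) (ModuleCat.of R X) j)

theorem extZero_succ_iff [Module.Projective R P] (i : K →ₗ[R] P) (p : P →ₗ[R] L)
    (hi : Function.Injective i) (hp : Function.Surjective p) (hip : Function.Exact i p)
    (X : Type v) [AddCommGroup X] [Module R X] (j : ℕ) :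
    ExtZero R (j + 2) L X ↔ ExtZero R (j + 1) K X := by
  let Sq : ShortComplex (ModuleCat.{v} R) := ModuleCat.shortComplexOfCompEqZero i p hip.linearMap_comp_eq_zero
  have hSq : Sq.ShortExact := ModuleCat.shortComplex_shortExact _ hip hi hp
  have : Projective Sq.X₂ := (IsProjective.iff_projective P).1 inferInstance
  constructor
  · intro h
    refine subsingleton_of_forall_eq 0 fun x => ?_
    obtain ⟨y, rfl⟩ := Ext.contravariant_sequence_exact₁ hSq (ModuleCat.of R X) x
      (n₁ := j + 2) (by omega) (h.elim _ _)
    rw [Ext.eq_zero_of_projective y, Ext.comp_zero]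
  · intro h
    refine subsingleton_of_forall_eq 0 fun x => ?_
    obtain ⟨y, rfl⟩ := Ext.contravariant_sequence_exact₃ hSq (ModuleCat.of R X) x
      (Ext.eq_zero_of_projective _) (n₀ := j + 1) (by omega)
    rw [h.elim y 0, Ext.comp_zero]

theorem extZero_one_iff [Module.Projective R P] (i : K →ₗ[R] P) (p : P →ₗ[R] L)
    (hi : Function.Injective i) (hp : Function.Surjective p) (hip : Function.Exact i p)
    (X : Type v) [AddCommGroup X] [Module R X] :
    ExtZero R 1 L X ↔ ∀ f : K →ₗ[R] X, ∃ g : P →ₗ[R] X, g ∘ₗ i = f := by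
  let Sq : ShortComplex (ModuleCat.{v} R) := ModuleCat.shortComplexOfCompEqZero i p hip.linearMap_comp_eq_zero
  have hSq : Sq.ShortExact := ModuleCat.shortComplex_shortExact _ hip hi hp
  have : Projective Sq.X₂ := (IsProjective.iff_projective P).1 inferInstance
  constructor
  · intro h f
    obtain ⟨y, hy⟩ := Ext.contravariant_sequence_exact₁ hSq (ModuleCat.of R X)
      (Ext.mk₀ (ModuleCat.ofHom f)) (n₁ := 1) (by omega) (h.elim _ _)
    obtain ⟨g, rfl⟩ := (Ext.mk₀_bijective _ _).2 y
    rw [Ext.mk₀_comp_mk₀] at hy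
    have := (Ext.mk₀_bijective _ _).1 hy
    exact ⟨g.hom, congrArg ModuleCat.Hom.hom this⟩
  · intro h
    refine subsingleton_of_forall_eq 0 fun x => ?_
    obtain ⟨y, rfl⟩ := Ext.contravariant_sequence_exact₃ hSq (ModuleCat.of R X) x
      (Ext.eq_zero_of_projective _) (n₀ := 0) (by omega)
    obtain ⟨f, rfl⟩ := (Ext.mk₀_bijective _ _).2 y
    obtain ⟨g, hg⟩ := h f.hom
    have hf : f = Sq.f ≫ ModuleCat.ofHom g := by
      ext x
      exact (LinearMap.congr_fun hg x).symm
    rw [hf, ← Ext.mk₀_comp_mk₀, hSq.extClass_comp_assoc]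
end Ext

/-! ### Extending maps along a presentation -/

section Extension

variable {R : Type v} [Ring R] {P₁ K P₀ M : Type v} [AddCommGroup P₁] [Module R P₁]
  [AddCommGroup K] [Module R K] [AddCommGroup P₀] [Module R P₀] [AddCommGroup M] [Module R M]

/-- If every map `P₁ ⟶ M` extends along `P₁ ⟶ K ⟶ P₀`, then every map from `K` to a quotient
of `M` extends to `P₀`. -/
theorem exists_extension_quotient [Module.Projective R P₁] (π : P₁ →ₗ[R] K)
    (hπ : Function.Surjective π) (i : K →ₗ[R] P₀)
    (h : ∀ g : P₁ →ₗ[R] M, ∃ g' : P₀ →ₗ[R] M, g' ∘ₗ i ∘ₗ π = g)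
    {X : Type v} [AddCommGroup X] [Module R X] (q : M →ₗ[R] X) (hq : Function.Surjective q)
    (f : K →ₗ[R] X) : ∃ g : P₀ →ₗ[R] X, g ∘ₗ i = f := by
  obtain ⟨g, hg⟩ := Module.projective_lifting_property q (f ∘ₗ π) hq
  obtain ⟨g', hg'⟩ := h g
  refine ⟨q ∘ₗ g', ?_⟩
  rw [← LinearMap.cancel_right hπ, ← hg, ← hg']
  rfl

/-- The converse of `exists_extension_quotient`, for a surjection with superfluous kernel. -/
theorem exists_extension_of_quotient [IsArtinian R M] [Module.Projective R P₀] (π : P₁ →ₗ[R] K)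
    (hπ : Function.Surjective π)
    (hker : ∀ N : Submodule R P₁, N ⊔ LinearMap.ker π = ⊤ → N = ⊤) (i : K →ₗ[R] P₀)
    (h : ∀ (W : Submodule R M) (f : K →ₗ[R] M ⧸ W), ∃ g : P₀ →ₗ[R] M ⧸ W, g ∘ₗ i = f)
    (g : P₁ →ₗ[R] M) : ∃ g' : P₀ →ₗ[R] M, g' ∘ₗ i ∘ₗ π = g := by
  -- Subtracting from `g` a map that does extend pushes its image into `g (ker π)`. The descending
  -- chain condition on `M` makes this stop, and superfluity of `ker π` forces the image to be zero
  -- when it no longer shrinks.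
  induction hW : LinearMap.range g using WellFoundedLT.induction generalizing g with
  | ind V ih =>
    let W := (LinearMap.ker π).map g
    have hle : LinearMap.ker π ≤ LinearMap.ker (W.mkQ ∘ₗ g) := by
      intro x hx
      rw [LinearMap.mem_ker, LinearMap.comp_apply, Submodule.mkQ_apply,
        Submodule.Quotient.mk_eq_zero]
      exact ⟨x, hx, rfl⟩
    let e := π.quotKerEquivOfSurjective hπ
    let f : K →ₗ[R] M ⧸ W := (LinearMap.ker π).liftQ (W.mkQ ∘ₗ g) hle ∘ₗ e.symm.toLinearMap
    have hf : f ∘ₗ π = W.mkQ ∘ₗ g := by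
      ext x
      have : e.symm (π x) = Submodule.Quotient.mk x := by
        rw [LinearEquiv.symm_apply_eq]; rfl
      simp only [f, LinearMap.comp_apply, LinearEquiv.coe_coe, this]
      rfl
    obtain ⟨f', hf'⟩ := h W f
    obtain ⟨g₀, hg₀⟩ := Module.projective_lifting_property W.mkQ f' W.mkQ_surjective
    let g₁ := g - g₀ ∘ₗ i ∘ₗ π
    have hg₁ : LinearMap.range g₁ ≤ W := by
      rintro _ ⟨x, rfl⟩
      have h1 := LinearMap.congr_fun hf x
      have h2 := LinearMap.congr_fun hg₀ (i (π x))
      have h3 := LinearMap.congr_fun hf' (π x)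
      simp only [LinearMap.comp_apply] at h1 h2 h3
      rw [← Submodule.Quotient.mk_eq_zero, ← Submodule.mkQ_apply]
      simp only [g₁, LinearMap.sub_apply, LinearMap.comp_apply, map_sub]
      rw [h2, h3, h1, sub_self]
    have hWV : W ≤ V := by
      rw [← hW]; exact LinearMap.map_le_range
    by_cases hlt : LinearMap.range g₁ < V
    · obtain ⟨g', hg'⟩ := ih _ hlt g₁ rfl
      refine ⟨g' + g₀, ?_⟩
      rw [LinearMap.add_comp, hg']
      simp [g₁]
    -- No shrinking means `g (ker π)` is the whole image of `g`, so `ker g + ker π` is everything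
    -- and superfluity gives `g = 0`.
    · have hWV' : W = LinearMap.range g := by
        rw [hW]
        exact (hWV.antisymm (by
          by_contra hc
          exact hlt (lt_of_le_of_ne (hg₁.trans hWV) fun heq => hc (heq ▸ hg₁))))
      have hg : g = 0 := by
        rw [← LinearMap.ker_eq_top]
        apply hker
        rw [eq_top_iff]
        intro x _
        obtain ⟨y, hy, hxy⟩ : g x ∈ W := hWV' ▸ ⟨x, rfl⟩
        rw [← sub_add_cancel x y]
        exact Submodule.add_mem_sup (by simp [hxy]) hy
      exact ⟨0, by simp [hg]⟩

end Extension
end HigherAR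

namespace HigherAR

/-! ### Maps into the `n`-Auslander--Reiten translate -/

theorem extZero_congr {R : Type v} [Ring R] {L L' : Type v} [AddCommGroup L] [Module R L]
    [AddCommGroup L'] [Module R L'] (e : L ≃ₗ[R] L') (X : Type v) [AddCommGroup X] [Module R X]
    (j : ℕ) : ExtZero R j L X ↔ ExtZero R j L' X := by
  have key : ∀ {L L' : ModuleCat.{v} R} (i : L ≅ L'),
      Subsingleton (Abelian.Ext.{v} L (ModuleCat.of R X) j) →
        Subsingleton (Abelian.Ext.{v} L' (ModuleCat.of R X) j) := by
    intro L L' i h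
    refine subsingleton_of_forall_eq 0 fun x => ?_
    rw [← Abelian.Ext.mk₀_id_comp x, ← i.inv_hom_id, ← Abelian.Ext.mk₀_comp_mk₀_assoc,
      h.elim ((Abelian.Ext.mk₀ i.hom).comp x (zero_add j)) 0, Abelian.Ext.comp_zero]
  exact ⟨key e.toModuleIso, key e.symm.toModuleIso⟩

theorem exists_dual_basis (R : Type v) [Ring R] (P : Type v) [AddCommGroup P] [Module R P]
    [Module.Finite R P] [Module.Projective R P] :
    ∃ (m : ℕ) (p : Fin m → P) (f : Fin m → P →ₗ[R] R), ∀ x, ∑ i, f i x • p i = x := by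
  obtain ⟨m, F, hF⟩ := Module.Finite.exists_fin' R P
  obtain ⟨s, hs⟩ := F.exists_rightInverse_of_surjective (LinearMap.range_eq_top.2 hF)
  refine ⟨m, fun i => F (Pi.single i 1), fun i => LinearMap.proj i ∘ₗ s, fun x => ?_⟩
  conv_rhs => rw [← LinearMap.id_apply (R := R) x, ← hs, LinearMap.comp_apply,
    pi_eq_sum_univ' (s x)]
  simp [map_sum]

section Nakayama

variable (k : Type w) [Field k] {R : Type v} [Ring R] [Algebra k R]

variable {k} in
/-- An element of the Nakayama module as a functional. -/
def Nakayama.toDual {P : Type v} [AddCommGroup P] [Module R P] (φ : Nakayama k R P) :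
    (P →ₗ[R] R) →ₗ[k] k := φ

variable {k} in
theorem Nakayama.ext_toDual {P : Type v} [AddCommGroup P] [Module R P] {φ ψ : Nakayama k R P}
    (h : ∀ f, φ.toDual f = ψ.toDual f) : φ = ψ := LinearMap.ext h

variable {P₁ P₀ M : Type v} [AddCommGroup P₁] [Module R P₁] [AddCommGroup P₀] [Module R P₀]
  [AddCommGroup M] [Module R M] [Module.Finite R P₁] [Module.Projective R P₁]

/-- One half of the duality `Hom(M, ν P) ≅ D Hom(P, M)`, in coordinates. With dual bases, `h m φ` is
a sum of values of `h` at the elements `φ (p i) • m`. Extending `x ↦ φ x • m` along `d` rewrites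
these so that the sum regroups into values at functionals `e j ∘ d`, which vanish on the kernel. -/
theorem eq_zero_of_exists_extension [Module.Finite R P₀] [Module.Projective R P₀]
    (d : P₁ →ₗ[R] P₀)
    (hd : ∀ g : P₁ →ₗ[R] M, ∃ g' : P₀ →ₗ[R] M, g' ∘ₗ d = g)
    (h : M →ₗ[R] LinearMap.ker (Nakayama.map k d)) : h = 0 := by
  obtain ⟨m₁, p, f, hpf⟩ := exists_dual_basis R P₁
  obtain ⟨m₀, q, e, hqe⟩ := exists_dual_basis R P₀
  let h' : M → (P₁ →ₗ[R] R) →ₗ[k] k := fun m => Nakayama.toDual (h m).1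
  have hadd : ∀ (m₁ m₂ : M), h' (m₁ + m₂) = h' m₁ + h' m₂ := fun m₁ m₂ => by
    simp only [h', map_add]; rfl
  have hsum : ∀ {ι : Type} (s : Finset ι) (g : ι → M), h' (∑ i ∈ s, g i) = ∑ i ∈ s, h' (g i) :=
    fun s g => map_sum (AddMonoidHom.mk' h' hadd) g s
  have hsmul : ∀ (r : R) (m : M) (f : P₁ →ₗ[R] R),
      h' (r • m) f = h' m (LinearMap.toSpanSingleton R R r ∘ₗ f) := fun r m f => by
    simp only [h', map_smul]; rfl
  have hker : ∀ (m : M) (f : P₀ →ₗ[R] R), h' m (f ∘ₗ d) = 0 := fun m f =>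
    LinearMap.congr_fun (show LinearMap.comp (h' m) (LinearMap.lcomp k R d) = 0 from (h m).2) f
  ext m : 1
  refine Subtype.ext (Nakayama.ext_toDual fun φ => ?_)
  change h' m φ = 0
  obtain ⟨g', hg'⟩ := hd (LinearMap.toSpanSingleton R M m ∘ₗ φ)
  have h1 : φ = ∑ i, LinearMap.toSpanSingleton R R (φ (p i)) ∘ₗ f i := by
    ext x
    conv_lhs => rw [← hpf x]
    simp
  have h2 : ∀ i, φ (p i) • m = ∑ j, e j (d (p i)) • g' (q j) := fun i => by
    have := LinearMap.congr_fun hg' (p i)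
    simp only [LinearMap.comp_apply, LinearMap.toSpanSingleton_apply] at this
    rw [← this]
    conv_lhs => rw [← hqe (d (p i))]
    simp
  have h3 : ∀ j, e j ∘ₗ d = ∑ i, LinearMap.toSpanSingleton R R (e j (d (p i))) ∘ₗ f i := by
    intro j
    ext x
    conv_lhs => rw [← hpf x]
    simp
  calc h' m φ = ∑ i, h' m (LinearMap.toSpanSingleton R R (φ (p i)) ∘ₗ f i) := by
        conv_lhs => rw [h1, map_sum]
    _ = ∑ i, ∑ j, h' (g' (q j)) (LinearMap.toSpanSingleton R R (e j (d (p i))) ∘ₗ f i) := by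
        refine Finset.sum_congr rfl fun i _ => ?_
        rw [← hsmul, h2, hsum, LinearMap.sum_apply]
        simp only [hsmul]
    _ = ∑ j, h' (g' (q j)) (e j ∘ₗ d) := by
        rw [Finset.sum_comm]
        refine Finset.sum_congr rfl fun j _ => ?_
        conv_rhs => rw [h3, map_sum]
    _ = 0 := Finset.sum_eq_zero fun j _ => hker _ _

/-- The other half of the duality: a functional `ξ` on `Hom(P₁, M)` that kills all extendable maps
but not `g` would yield the map `m ↦ (φ ↦ ξ (φ(-) • m))` into the kernel. If that map is zero, then
`ξ` kills everything, since the maps `φ(-) • m` span `Hom(P₁, M)`. -/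
theorem exists_extension_of_eq_zero (d : P₁ →ₗ[R] P₀)
    (H : ∀ h : M →ₗ[R] LinearMap.ker (Nakayama.map k d), h = 0)
    (g : P₁ →ₗ[R] M) : ∃ g' : P₀ →ₗ[R] M, g' ∘ₗ d = g := by
  let : Module k M := Module.compHom M (algebraMap k R)
  have : IsScalarTower k R M := ⟨fun c r m => by
    rw [Algebra.smul_def, mul_smul]; rfl⟩
  obtain ⟨m₁, p, f, hpf⟩ := exists_dual_basis R P₁
  by_contra hg
  have hg' : g ∉ LinearMap.range (LinearMap.lcomp k M d : (P₀ →ₗ[R] M) →ₗ[k] P₁ →ₗ[R] M) :=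
    fun ⟨g', h⟩ => hg ⟨g', h⟩
  obtain ⟨ξ, hξ, hle⟩ := Submodule.exists_le_ker_of_notMem hg'
  have hξ0 : ∀ g' : P₀ →ₗ[R] M, ξ (g' ∘ₗ d) = 0 := fun g' => hle ⟨g', rfl⟩
  let h₀ : M →ₗ[R] Nakayama k R P₁ :=
    { toFun := fun m => (
        { toFun := fun φ => ξ (LinearMap.toSpanSingleton R M m ∘ₗ φ)
          map_add' := fun φ ψ => by rw [LinearMap.comp_add, map_add]
          map_smul' := fun c φ => by
            rw [RingHom.id_apply, ← map_smul]
            congr 1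
            ext x
            simp } : (P₁ →ₗ[R] R) →ₗ[k] k)
      map_add' := fun m m' => by
        refine Nakayama.ext_toDual fun φ => ?_
        change ξ _ = ξ _ + ξ _
        rw [← map_add]
        congr 1
        ext x
        simp
      map_smul' := fun r m => by
        refine Nakayama.ext_toDual fun φ => ?_
        change ξ _ = ξ _
        congr 1
        ext x
        simp [Nakayama.mulRight, mul_smul] }
  have hmem : ∀ m, h₀ m ∈ LinearMap.ker (Nakayama.map k d) := fun m =>
    Nakayama.ext_toDual (P := P₀) fun φ => hξ0 (LinearMap.toSpanSingleton R M m ∘ₗ φ)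
  have h0 : ∀ m (φ : P₁ →ₗ[R] R), ξ (LinearMap.toSpanSingleton R M m ∘ₗ φ) = 0 := fun m φ => by
    have := congrArg Subtype.val (LinearMap.congr_fun (H (h₀.codRestrict _ hmem)) m)
    exact LinearMap.congr_fun (show (h₀ m).toDual = 0 from this) φ
  apply hξ
  have : g = ∑ i, LinearMap.toSpanSingleton R M (g (p i)) ∘ₗ f i := by
    ext x
    conv_lhs => rw [← hpf x]
    simp
  rw [this, map_sum]
  exact Finset.sum_eq_zero fun i _ => h0 _ _

end Nakayama

section

variable (k : Type w) [Field k] {R : Type v} [Ring R] [Algebra k R] [Module.Finite k R]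

theorem extZero_syzygy_iterate (m : ℕ) (N : FGModuleCat.{v} R) (X : Type v) [AddCommGroup X]
    [Module R X] : ExtZero R 1 ((syzygy k)^[m] N) X ↔ ExtZero R (m + 1) N X := by
  induction m generalizing N with
  | zero => rfl
  | succ m ih =>
    rw [Function.iterate_succ_apply, ih]
    have := (cover k N).projective
    exact (extZero_succ_iff (LinearMap.ker (cover k N).π).subtype (cover k N).π
      (Submodule.subtype_injective _) (cover k N).surjective
      (LinearMap.exact_subtype_ker_map _) X m).symm

/-- Both sides say that maps extend along the presentation of `L`: on the left, maps `P₁ ⟶ M`; on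
the right, maps from the syzygy to quotients of `M`. Minimality of the cover `P₁` of the syzygy
makes the two agree. -/
theorem forall_tau_eq_zero_iff (M L : FGModuleCat.{v} R) :
    (∀ f : M →ₗ[R] tau k L, f = 0) ↔
      ∀ (X : Type v) [AddCommGroup X] [Module R X] (q : M →ₗ[R] X), Function.Surjective q →
        ExtZero R 1 L X := by
  have h0 := (cover k L).projective
  have h1 := (cover k (syzygy k L)).projective
  have hart : IsArtinianRing R := IsArtinianRing.of_finite k R
  have hext : ∀ (X : Type v) [AddCommGroup X] [Module R X], ExtZero R 1 L X ↔ _ := fun X _ _ =>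
    extZero_one_iff (LinearMap.ker (cover k L).π).subtype (cover k L).π
      (Submodule.subtype_injective _) (cover k L).surjective
      (LinearMap.exact_subtype_ker_map _) X
  constructor
  · intro H X _ _ q hq
    rw [hext]
    exact exists_extension_quotient (cover k (syzygy k L)).π (cover k (syzygy k L)).surjective _
      (exists_extension_of_eq_zero k (presentation k L) H) q hq
  · intro H
    refine eq_zero_of_exists_extension k (presentation k L) ?_
    exact exists_extension_of_quotient (cover k (syzygy k L)).π (cover k (syzygy k L)).surjective
      (cover k (syzygy k L)).superfluous _
      fun W => (hext _).1 (H _ W.mkQ W.mkQ_surjective)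

/-- `Hom(M, τ_n N) = 0` if and only if `Ext^n(N, X) = 0` for all quotients `X` of `M`. -/
theorem homTauZero_iff {n : ℕ} (hn : 1 ≤ n) (M N : FGModuleCat.{v} R) :
    HomTauZero k n M N ↔
      ∀ (X : Type v) [AddCommGroup X] [Module R X] (q : M →ₗ[R] X), Function.Surjective q →
        ExtZero R n N X := by
  obtain ⟨m, rfl⟩ : ∃ m, n = m + 1 := ⟨n - 1, by omega⟩
  refine (forall_tau_eq_zero_iff k M ((syzygy k)^[m] N)).trans ?_
  simp only [extZero_syzygy_iterate]

/-- The `Ext` criterion gives invariance without comparing the chosen projective covers. -/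
theorem HomTauZero.of_equiv {n : ℕ} (hn : 1 ≤ n) {M M' N N' : FGModuleCat.{v} R}
    (e : M ≃ₗ[R] M') (e' : N ≃ₗ[R] N') (h : HomTauZero k n M N) : HomTauZero k n M' N' := by
  rw [homTauZero_iff k hn] at h ⊢
  intro X _ _ q hq
  have := h X (q ∘ₗ e.toLinearMap) (hq.comp e.surjective)
  exact (extZero_congr e' X n).1 this

end

end HigherAR

namespace HigherAngulated

/-! ### Direct summands in additive categories -/

section Additive

variable {C : Type u} [Category.{v} C] [Preadditive C] [HasFiniteBiproducts C]

theorem IsSummand.exists_retract {X Z : C} (h : IsSummand X Z) :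
    ∃ (s : X ⟶ Z) (r : Z ⟶ X), s ≫ r = 𝟙 X := by
  obtain ⟨Y, ⟨e⟩⟩ := h
  exact ⟨biprod.inl ≫ e.hom, e.inv ≫ biprod.fst, by simp⟩

theorem IsSummand.of_retract [IsIdempotentComplete C] {X Z : C} (s : X ⟶ Z) (r : Z ⟶ X)
    (h : s ≫ r = 𝟙 X) : IsSummand X Z := by
  obtain ⟨Y, i, e, hie, hei⟩ := IsIdempotentComplete.idempotents_split Z (𝟙 Z - r ≫ s) (by
    simp [Preadditive.sub_comp, Preadditive.comp_sub, reassoc_of% h])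
  have h1 : i ≫ r = 0 := by
    have : i ≫ (𝟙 Z - r ≫ s) ≫ r = i ≫ r := by rw [← hei]; simp [reassoc_of% hie]
    rw [← this]; simp [Preadditive.sub_comp, h]
  have h2 : s ≫ e = 0 := by
    have : s ≫ (𝟙 Z - r ≫ s) ≫ e = s ≫ e := by rw [← hei]; simp [hie]
    rw [← this]; simp [Preadditive.sub_comp, Preadditive.comp_sub, reassoc_of% h]
  refine ⟨Y, ⟨⟨biprod.desc s i, biprod.lift r e, ?_, ?_⟩⟩⟩
  · ext <;> simp [h, h1, h2, hie]
  · simp [hei]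

/-- Together with `add.exists_sum`, this describes `add M` as the objects whose identity is a sum of
endomorphisms through `M`; later arguments use this form rather than biproducts. -/
theorem add_of_sum [IsIdempotentComplete C] {ι : Type*} [Fintype ι] {M X : C}
    (p : ι → (X ⟶ M)) (q : ι → (M ⟶ X)) (h : ∑ i, p i ≫ q i = 𝟙 X) : add M X := by
  let e := Fintype.equivFin ι
  refine ⟨Fintype.card ι, IsSummand.of_retract (biproduct.lift fun j => p (e.symm j))
    (biproduct.desc fun j => q (e.symm j)) ?_⟩
  rw [biproduct.lift_desc, ← h]
  exact Fintype.sum_equiv e.symm _ _ fun _ => rfl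

theorem add.exists_sum {M X : C} (h : add M X) :
    ∃ (m : ℕ) (p : Fin m → (X ⟶ M)) (q : Fin m → (M ⟶ X)), ∑ i, p i ≫ q i = 𝟙 X := by
  obtain ⟨m, hm⟩ := h
  obtain ⟨s, r, hsr⟩ := hm.exists_retract
  refine ⟨m, fun i => s ≫ biproduct.π _ i, fun i => biproduct.ι (fun _ : Fin m => M) i ≫ r, ?_⟩
  calc _ = s ≫ (∑ i, biproduct.π _ i ≫ biproduct.ι (fun _ : Fin m => M) i) ≫ r := by
        rw [Preadditive.sum_comp, Preadditive.comp_sum]; simp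
    _ = 𝟙 X := by rw [biproduct.total]; simpa using hsr

variable [IsIdempotentComplete C]

theorem add.trans {X Y Z : C} (h : add Y X) (h' : add Z Y) : add Z X := by
  obtain ⟨m, p, q, hpq⟩ := h.exists_sum
  obtain ⟨m', p', q', hpq'⟩ := h'.exists_sum
  refine add_of_sum (ι := Fin m × Fin m') (fun i => p i.1 ≫ p' i.2) (fun i => q' i.2 ≫ q i.1) ?_
  rw [Fintype.sum_prod_type, ← hpq]
  refine Finset.sum_congr rfl fun i _ => ?_
  calc _ = p i ≫ (∑ j, p' j ≫ q' j) ≫ q i := by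
        simp [Preadditive.sum_comp, Preadditive.comp_sum]
    _ = _ := by rw [hpq']; simp

theorem add_of_retract {X Y : C} (s : X ⟶ Y) (r : Y ⟶ X) (h : s ≫ r = 𝟙 X) : add Y X :=
  add_of_sum (ι := Unit) (fun _ => s) (fun _ => r) (by simpa using h)

theorem add_self (X : C) : add X X := add_of_retract (𝟙 X) (𝟙 X) (by simp)

theorem add_of_iso {X Y : C} (e : X ≅ Y) : add Y X := add_of_retract e.hom e.inv (by simp)

theorem add_of_isZero (M : C) {X : C} (h : IsZero X) : add M X :=
  add_of_sum (ι := Empty) (fun i => i.elim) (fun i => i.elim) (h.eq_of_src _ _)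

theorem add_biprod {M X Y : C} (hX : add M X) (hY : add M Y) : add M (X ⊞ Y) := by
  obtain ⟨m, p, q, hpq⟩ := hX.exists_sum
  obtain ⟨m', p', q', hpq'⟩ := hY.exists_sum
  refine add_of_sum (ι := Fin m ⊕ Fin m')
    (Sum.elim (fun i => biprod.fst ≫ p i) (fun i => biprod.snd ≫ p' i))
    (Sum.elim (fun i => q i ≫ biprod.inl) (fun i => q' i ≫ biprod.inr)) ?_
  rw [Fintype.sum_sum_type]
  calc _ = biprod.fst ≫ (∑ j, p j ≫ q j) ≫ biprod.inl +
        biprod.snd ≫ (∑ j, p' j ≫ q' j) ≫ biprod.inr := by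
        simp [Preadditive.sum_comp, Preadditive.comp_sum]
    _ = _ := by rw [hpq, hpq']; simp

theorem add_biproduct {m : ℕ} (M : C) : add M (⨁ fun _ : Fin m => M) :=
  add_of_sum (fun j => biproduct.π _ j) (fun j => biproduct.ι (fun _ : Fin m => M) j)
    (by rw [biproduct.total])

omit [Preadditive C] [HasFiniteBiproducts C] [IsIdempotentComplete C] in
/-- If `u ≫ v` and `v ≫ u` are isomorphisms, so is `u`. -/
theorem isIso_of_isIso_comp {X Y : C} (a : X ⟶ Y) (b : Y ⟶ X) (h : IsIso (a ≫ b))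
    (h' : IsIso (b ≫ a)) : IsIso a := by
  refine ⟨⟨b ≫ inv (a ≫ b), by rw [← Category.assoc, IsIso.hom_inv_id], ?_⟩⟩
  rw [← cancel_epi (b ≫ a)]
  calc (b ≫ a) ≫ (b ≫ inv (a ≫ b)) ≫ a = b ≫ ((a ≫ b) ≫ inv (a ≫ b)) ≫ a := by
        simp only [Category.assoc]
    _ = _ := by rw [IsIso.hom_inv_id]; simp

-- The inverse is `1 + b (1 - a b)⁻¹ a`, as for elements of a ring.
omit [HasFiniteBiproducts C] [IsIdempotentComplete C] in
theorem isIso_one_sub_swap {X Y : C} (a : X ⟶ Y) (b : Y ⟶ X) (h : IsIso (𝟙 X - a ≫ b)) :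
    IsIso (𝟙 Y - b ≫ a) := by
  have h1 : a ≫ b ≫ inv (𝟙 X - a ≫ b) = inv (𝟙 X - a ≫ b) - 𝟙 X := by
    rw [eq_sub_iff_add_eq, ← eq_sub_iff_add_eq', ← Category.assoc, ← Category.id_comp
      (inv (𝟙 X - a ≫ b)), ← Category.assoc, Category.comp_id, ← Preadditive.sub_comp,
      IsIso.hom_inv_id]
  have h2 : inv (𝟙 X - a ≫ b) ≫ a ≫ b = inv (𝟙 X - a ≫ b) - 𝟙 X := by
    rw [eq_sub_iff_add_eq, ← eq_sub_iff_add_eq', ← Category.comp_id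
      (inv (𝟙 X - a ≫ b)), Category.assoc, Category.id_comp, ← Preadditive.comp_sub,
      IsIso.inv_hom_id]
  refine ⟨⟨𝟙 Y + b ≫ inv (𝟙 X - a ≫ b) ≫ a, ?_, ?_⟩⟩
  · have : b ≫ (a ≫ b ≫ inv (𝟙 X - a ≫ b)) ≫ a = b ≫ inv (𝟙 X - a ≫ b) ≫ a - b ≫ a := by
      rw [h1]; simp [Preadditive.sub_comp, Preadditive.comp_sub]
    simp only [Category.assoc] at this
    simp [Preadditive.sub_comp, Preadditive.comp_add, this]
  · have : b ≫ (inv (𝟙 X - a ≫ b) ≫ a ≫ b) ≫ a = b ≫ inv (𝟙 X - a ≫ b) ≫ a - b ≫ a := by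
      rw [h2]; simp [Preadditive.sub_comp, Preadditive.comp_sub]
    simp only [Category.assoc] at this
    simp [Preadditive.comp_sub, Preadditive.add_comp, this]

/-- Every endomorphism of `X` factoring through `W` is in the radical. -/
def RadicalThrough (X W : C) : Prop := ∀ (a : X ⟶ W) (b : W ⟶ X), IsIso (𝟙 X - a ≫ b)

-- One summand at a time: with `s` the sum so far, `1 - s - a b = (1 - s)(1 - (1 - s)⁻¹ a b)`.
omit [HasFiniteBiproducts C] [IsIdempotentComplete C] in
theorem RadicalThrough.isIso_sub_sum {X W : C} (h : RadicalThrough X W) {ι : Type*}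
    (s : Finset ι) (a : ι → (X ⟶ W)) (b : ι → (W ⟶ X)) : IsIso (𝟙 X - ∑ i ∈ s, a i ≫ b i) := by
  classical
  induction s using Finset.induction_on with
  | empty => simp only [Finset.sum_empty, sub_zero]; infer_instance
  | insert i s hi ih =>
    have := h (inv (𝟙 X - ∑ i ∈ s, a i ≫ b i) ≫ a i) (b i)
    have heq : 𝟙 X - ∑ i ∈ insert i s, a i ≫ b i =
        (𝟙 X - ∑ i ∈ s, a i ≫ b i) ≫
          (𝟙 X - (inv (𝟙 X - ∑ i ∈ s, a i ≫ b i) ≫ a i) ≫ b i) := by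
      rw [Preadditive.comp_sub, Category.assoc, IsIso.hom_inv_id_assoc, Finset.sum_insert hi,
        Category.comp_id]
      abel
    rw [heq]
    infer_instance

/-- In an expression of `𝟙 X` through copies of `W ⊞ V`, the part through `W` is radical. The part
through `V` is therefore invertible, and dividing by it exhibits `X` in `add V`. -/
theorem RadicalThrough.add_of_add_biprod {X W V : C} (h : RadicalThrough X W)
    (hX : add (W ⊞ V) X) : add V X := by
  obtain ⟨m, p, q, hpq⟩ := hX.exists_sum
  have := h.isIso_sub_sum Finset.univ (fun i => p i ≫ biprod.fst) (fun i => biprod.inl ≫ q i)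
  have heq : 𝟙 X - ∑ i, (p i ≫ biprod.fst) ≫ biprod.inl ≫ q i =
      ∑ i, (p i ≫ biprod.snd) ≫ biprod.inr ≫ q i := by
    rw [sub_eq_iff_eq_add, ← hpq, ← Finset.sum_add_distrib]
    refine Finset.sum_congr rfl fun i _ => ?_
    calc _ = p i ≫ (biprod.fst ≫ biprod.inl + biprod.snd ≫ biprod.inr) ≫ q i := by simp
      _ = _ := by simp only [Preadditive.add_comp, Preadditive.comp_add, Category.assoc, add_comm]
  rw [heq] at this
  refine add_of_sum (fun i => p i ≫ biprod.snd) (fun i => biprod.inr ≫ q i ≫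
    inv (∑ i, (p i ≫ biprod.snd) ≫ biprod.inr ≫ q i)) ?_
  refine Eq.trans ?_ (IsIso.hom_inv_id (∑ i, (p i ≫ biprod.snd) ≫ biprod.inr ≫ q i))
  rw [Preadditive.sum_comp]
  simp only [Category.assoc]

/-! ### Splitting off summands in a Hom-finite category -/

section HomFinite

variable (k : Type w) [Field k] [Linear k C] [∀ X Y : C, Module.Finite k (X ⟶ Y)]

include k

omit [HasFiniteBiproducts C] [IsIdempotentComplete C] in
/-- An endomorphism is nilpotent as soon as every idempotent that is a multiple of it vanishes. -/
theorem isNilpotent_of_idempotent {U : C} (r : End U)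
    (h : ∀ y : End U, (r ≫ y) ≫ (r ≫ y) = r ≫ y → r ≫ y = 0) : IsNilpotent r := by
  have : Module.Finite k (End U) := inferInstanceAs (Module.Finite k (U ⟶ U))
  have hint : IsIntegral k r := Algebra.IsIntegral.isIntegral r
  -- Fitting's lemma: factor the minimal polynomial as `X^m g` with `g` prime to `X`, and write `a
  -- X^(m+1) + b g = 1`. The value of `a X^(m+1)` at `r` is an idempotent multiple of `r`, hence
  -- zero. So `(b g)(r) = 1`, and `r^(m+1) = r^(m+1) (b g)(r) = 0`.
  obtain ⟨g, hg, hng⟩ := Polynomial.exists_eq_pow_rootMultiplicity_mul_and_not_dvd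
    (minpoly k r) (minpoly.ne_zero hint) 0
  set m := Polynomial.rootMultiplicity 0 (minpoly k r)
  rw [map_zero, sub_zero] at hg hng
  have hco : IsCoprime (Polynomial.X ^ (m + 1) : Polynomial k) g :=
    IsCoprime.pow_left ((Polynomial.irreducible_X.coprime_iff_not_dvd).2 hng)
  obtain ⟨a, b, hab⟩ := hco
  let φ := Polynomial.aeval (R := k) r
  have h0 : φ (Polynomial.X ^ m * g) = 0 := by rw [← hg]; exact minpoly.aeval k r
  have h1 : φ (a * Polynomial.X ^ (m + 1)) = 1 - φ (b * g) := by
    rw [eq_sub_iff_add_eq, ← map_add, hab, map_one]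
  have he : r ≫ φ (a * Polynomial.X ^ m) = φ (a * Polynomial.X ^ (m + 1)) := by
    change φ (a * Polynomial.X ^ m) * r = _
    rw [pow_succ, ← mul_assoc, map_mul φ _ Polynomial.X]
    simp [φ]
  have hidem : φ (a * Polynomial.X ^ (m + 1)) * φ (a * Polynomial.X ^ (m + 1)) =
      φ (a * Polynomial.X ^ (m + 1)) := by
    refine Eq.trans (b := (1 - φ (b * g)) * φ (a * Polynomial.X ^ (m + 1))) (by rw [← h1]) ?_
    rw [sub_mul, one_mul, ← map_mul, show b * g * (a * Polynomial.X ^ (m + 1)) =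
      (a * b * Polynomial.X) * (Polynomial.X ^ m * g) by ring,
      map_mul φ (a * b * Polynomial.X), h0, mul_zero, sub_zero]
  have hz := h (φ (a * Polynomial.X ^ m)) (by rw [he]; exact hidem)
  rw [he, h1, sub_eq_zero] at hz
  refine ⟨m + 1, ?_⟩
  have : r ^ (m + 1) = φ (Polynomial.X ^ (m + 1)) := by simp [φ]
  rw [this, ← mul_one (φ _), hz, ← map_mul,
    show Polynomial.X ^ (m + 1) * (b * g) = (b * Polynomial.X) * (Polynomial.X ^ m * g) by ring,
    map_mul, h0, mul_zero]

/-- An idempotent multiple of `p ≫ q` splits through an object which is a summand of both `U` and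
`M`, hence zero. -/
theorem HasNoSummandInAdd.isNilpotent {M Y U : C} (h : HasNoSummandInAdd M Y) (hU : add Y U)
    (p : U ⟶ M) (q : M ⟶ U) : IsNilpotent (show End U from p ≫ q) := by
  refine isNilpotent_of_idempotent k _ fun y hy => ?_
  change ((p ≫ q) ≫ y) ≫ ((p ≫ q) ≫ y) = (p ≫ q) ≫ y at hy
  change (p ≫ q) ≫ y = 0
  obtain ⟨W, i, j, hij, hji⟩ := IsIdempotentComplete.idempotents_split U _ hy
  have hW : IsZero W := h W (IsSummand.of_retract (i ≫ p) (q ≫ y ≫ j) (by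
    calc (i ≫ p) ≫ q ≫ y ≫ j = i ≫ ((p ≫ q) ≫ y) ≫ j := by simp
      _ = 𝟙 W := by rw [← hji]; simp [hij]))
    ((add_of_retract i j hij).trans hU)
  rw [← hji, hW.eq_of_src i 0, comp_zero]

theorem HasNoSummandInAdd.radicalThrough {M Y U : C} (h : HasNoSummandInAdd M Y) (hU : add Y U) :
    RadicalThrough U M := fun p q =>
  (isUnit_iff_isIso _).1 (h.isNilpotent k hU p q).isUnit_one_sub

theorem HasNoSummandInAdd.radicalThrough_add {M Y U : C} (h : HasNoSummandInAdd M Y)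
    (hU : add Y U) : RadicalThrough M U := fun p q =>
  isIso_one_sub_swap q p (h.radicalThrough k hU q p)

/-- The identity of a common summand `Z` is the sum of an endomorphism through `M` and one through
`M'`. The second is `1` minus a radical map, so invertible, yet also nilpotent; hence `Z` is zero.
-/
theorem HasNoSummandInAdd.biprod {M M' Y : C} (h : HasNoSummandInAdd M Y)
    (h' : HasNoSummandInAdd M' Y) : HasNoSummandInAdd (M ⊞ M') Y := by
  intro Z hZ hYZ
  obtain ⟨s, r, hsr⟩ := hZ.exists_retract
  have h1 := h.radicalThrough k hYZ (s ≫ biprod.fst) (biprod.inl ≫ r)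
  obtain ⟨m, hm⟩ := h'.isNilpotent k hYZ (s ≫ biprod.snd) (biprod.inr ≫ r)
  have heq : 𝟙 Z - (s ≫ biprod.fst) ≫ biprod.inl ≫ r =
      (s ≫ biprod.snd) ≫ biprod.inr ≫ r := by
    rw [sub_eq_iff_eq_add, ← hsr]
    calc _ = s ≫ (biprod.fst ≫ biprod.inl + biprod.snd ≫ biprod.inr) ≫ r := by simp
      _ = _ := by simp only [Preadditive.add_comp, Preadditive.comp_add, Category.assoc, add_comm]
  rw [heq] at h1
  have h2 := ((isUnit_iff_isIso _).2 h1).pow m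
  rw [hm, isUnit_zero_iff] at h2
  exact (IsZero.iff_id_eq_zero Z).2 h2.symm

/-- Splitting off a non-zero summand in `add Y` strictly lowers the dimension of the endomorphism
algebra, so the process ends. -/
theorem exists_decomposition (Y X : C) :
    ∃ M V : C, HasNoSummandInAdd M Y ∧ add Y V ∧ Nonempty (M ⊞ V ≅ X) := by
  induction hd : Module.finrank k (X ⟶ X) using Nat.strong_induction_on generalizing X with
  | _ d ih =>
    by_cases hX : HasNoSummandInAdd X Y
    · obtain ⟨O, hO⟩ := (hasZeroObject_of_hasFiniteBiproducts C).zero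
      refine ⟨X, O, hX, add_of_isZero Y hO, ⟨⟨biprod.fst, biprod.inl, ?_, biprod.inl_fst⟩⟩⟩
      ext
      · simp
      · simp
      · exact hO.eq_of_src _ _
      · exact hO.eq_of_src _ _
    · simp only [HasNoSummandInAdd, not_forall] at hX
      obtain ⟨Z, ⟨W, ⟨e⟩⟩, hZ, hZ0⟩ := hX
      let L : (W ⟶ W) →ₗ[k] (X ⟶ X) :=
        { toFun := fun f => e.inv ≫ biprod.snd ≫ f ≫ biprod.inr ≫ e.hom
          map_add' := fun f g => by simp
          map_smul' := fun c f => by simp }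
      have hL : Function.Injective L := by
        intro f g hfg
        have := congrArg (fun t => biprod.inr ≫ e.hom ≫ t ≫ e.inv ≫ biprod.snd) hfg
        simpa [L] using this
      have hL' : ¬ Function.Surjective L := by
        intro hs
        obtain ⟨f, hf⟩ := hs (e.inv ≫ biprod.fst ≫ biprod.inl ≫ e.hom)
        have := congrArg (fun t => biprod.inl ≫ e.hom ≫ t ≫ e.inv ≫ biprod.fst) hf
        refine hZ0 ((IsZero.iff_id_eq_zero Z).2 (Eq.symm ?_))
        simpa [L] using this
      have hlt : Module.finrank k (W ⟶ W) < d := by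
        rw [← hd, ← LinearMap.finrank_range_of_inj hL]
        exact Submodule.finrank_lt (fun h => hL' (LinearMap.range_eq_top.1 h))
      obtain ⟨M, V, hM, hV, ⟨e'⟩⟩ := ih _ hlt W rfl
      refine ⟨M, Z ⊞ V, hM, add_biprod hZ hV, ⟨(biprod.associator M Z V).symm ≪≫
        biprod.mapIso (biprod.braiding M Z) (Iso.refl V) ≪≫ biprod.associator Z M V ≪≫
        biprod.mapIso (Iso.refl Z) e' ≪≫ e⟩⟩

/-- The diagonal blocks `V ⟶ V'` and `V' ⟶ V` of `e` and its inverse compose to the identity minus a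
map through `M'` or `M`, which is radical. -/
theorem nonempty_iso_of_biprod_iso {Y M V M' V' : C} (hM : HasNoSummandInAdd M Y)
    (hM' : HasNoSummandInAdd M' Y) (hV : add Y V) (hV' : add Y V') (e : M ⊞ V ≅ M' ⊞ V') :
    Nonempty (V ≅ V') := by
  let a : V ⟶ V' := biprod.inr ≫ e.hom ≫ biprod.snd
  let b : V' ⟶ V := biprod.inr ≫ e.inv ≫ biprod.snd
  have key : ∀ {M V M' V' : C} (e : M ⊞ V ≅ M' ⊞ V'),
      (biprod.inr ≫ e.hom ≫ biprod.snd) ≫ biprod.inr ≫ e.inv ≫ biprod.snd =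
        𝟙 V - (biprod.inr ≫ e.hom ≫ biprod.fst) ≫ biprod.inl ≫ e.inv ≫ biprod.snd := by
    intro M V M' V' e
    rw [eq_sub_iff_add_eq]
    calc _ = biprod.inr ≫ e.hom ≫ (biprod.fst ≫ biprod.inl + biprod.snd ≫ biprod.inr) ≫
          e.inv ≫ biprod.snd := by
          simp only [Preadditive.add_comp, Preadditive.comp_add, Category.assoc, add_comm]
      _ = _ := by simp
  have hab : IsIso (a ≫ b) := by
    rw [key e]; exact hM'.radicalThrough k hV _ _
  have hba : IsIso (b ≫ a) := by
    have := key e.symm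
    rw [Iso.symm_hom, Iso.symm_inv] at this
    rw [this]; exact hM.radicalThrough k hV' _ _
  have := isIso_of_isIso_comp a b hab hba
  exact ⟨asIso a⟩

end HomFinite

end Additive

end HigherAngulated

namespace HigherAngulated

/-! ### Exactness of angles -/

section Exactness

variable {C : Type u} [Category.{v} C] [Preadditive C]

/-- `f` is a weak kernel of `g` and `g` is a weak cokernel of `f`. -/
structure WeakExact {X Y Z : C} (f : X ⟶ Y) (g : Y ⟶ Z) : Prop where
  zero : f ≫ g = 0
  lift : ∀ {W : C} (h : W ⟶ Y), h ≫ g = 0 → ∃ h', h' ≫ f = h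
  desc : ∀ {W : C} (h : Y ⟶ W), f ≫ h = 0 → ∃ h', g ≫ h' = h

theorem WeakExact.of_iso {X Y Z X' Y' Z' : C} {f : X ⟶ Y} {g : Y ⟶ Z} {f' : X' ⟶ Y'} {g' : Y' ⟶ Z'}
    (h : WeakExact f g) (a : X ≅ X') (b : Y ≅ Y') (c : Z ≅ Z') (hf : f ≫ b.hom = a.hom ≫ f')
    (hg : g ≫ c.hom = b.hom ≫ g') : WeakExact f' g' := by
  have hf' : f' = a.inv ≫ f ≫ b.hom := by rw [hf]; simp
  have hg' : g' = b.inv ≫ g ≫ c.hom := by rw [hg]; simp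
  subst hf' hg'
  refine ⟨by simp [reassoc_of% h.zero], fun t ht => ?_, fun t ht => ?_⟩
  · obtain ⟨t', ht'⟩ := h.lift (t ≫ b.inv) (by simpa [← Category.assoc] using ht)
    exact ⟨t' ≫ a.hom, by simp [reassoc_of% ht']⟩
  · obtain ⟨t', ht'⟩ := h.desc (b.hom ≫ t) (by simpa using ht)
    exact ⟨c.inv ≫ t', by simp [ht']⟩

theorem WeakExact.of_unit_smul {X Y Z : C} {f : X ⟶ Y} {g : Y ⟶ Z} (j : ℕ)
    (h : WeakExact f ((-1 : ℤ) ^ j • g)) : WeakExact f g := by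
  refine h.of_iso (Iso.refl _) (Iso.refl _)
    ⟨(-1 : ℤ) ^ j • 𝟙 Z, (-1 : ℤ) ^ j • 𝟙 Z, ?_, ?_⟩ (by simp) ?_
  all_goals simp [smul_smul, ← mul_pow]

variable [HasFiniteBiproducts C] {S : C ⥤ C} {n : ℕ}

-- `IsLeftRotation` is a relation up to isomorphism, so `rotate_iff` needs a sequence realising it.
-- Transport along equalities of objects is confined to this construction.
omit [HasFiniteBiproducts C] in
theorem AngleSeq.exists_isLeftRotation (A : AngleSeq S n) : ∃ B, A.IsLeftRotation B := by
  let o : Fin (n + 2) → C := Fin.snoc (α := fun _ => C) (fun i => A.obj i.succ) (S.obj (A.obj 0))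
  have ho : ∀ i : Fin (n + 1), o i.castSucc = A.obj i.succ := fun i => by simp [o]
  have hl : o (Fin.last (n + 1)) = S.obj (A.obj 0) := by simp [o]
  let μ : ∀ i : Fin (n + 1), o i.castSucc ⟶ o i.succ :=
    Fin.lastCases (motive := fun i : Fin (n + 1) => o i.castSucc ⟶ o i.succ)
      (eqToHom (ho (Fin.last n)) ≫ A.last ≫ eqToHom hl.symm)
      (fun j => eqToHom (ho j.castSucc) ≫ A.map j.succ ≫ eqToHom (ho j.succ).symm)
  refine ⟨⟨o, μ, eqToHom hl ≫ ((-1 : ℤ) ^ n • S.map (A.map 0)) ≫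
    S.map (eqToHom (ho 0).symm)⟩, fun i => eqToIso (ho i), eqToIso hl, fun i => ?_, ?_, ?_⟩
  · simp only [μ, Fin.lastCases_castSucc]
    simp
  · simp only [μ, Fin.lastCases_last]
    simp
  · have : S.map (eqToHom (ho 0).symm) ≫ S.map (eqToHom (ho 0)) = 𝟙 _ := by
      rw [← S.map_comp, eqToHom_trans, eqToHom_refl, S.map_id]
    exact (Category.assoc _ _ _).trans (congrArg (fun t => _ ≫ t) ((Category.assoc _ _ _).trans
      ((congrArg (fun t => _ ≫ t) this).trans (Category.comp_id _))))

theorem exists_seq_pair (S : C ⥤ C) (n : ℕ) (j : Fin (n + 1)) (W : C) :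
    ∃ (A : AngleSeq S n) (e₀ : A.obj j.castSucc ≅ W) (e₁ : A.obj j.succ ≅ W),
      A.map j ≫ e₁.hom = e₀.hom ∧ ∀ i, i ≠ j.castSucc → i ≠ j.succ → IsZero (A.obj i) := by
  obtain ⟨O, hO⟩ := (hasZeroObject_of_hasFiniteBiproducts C).zero
  let o : Fin (n + 2) → C := fun i => if i = j.castSucc ∨ i = j.succ then W else O
  have h₀ : o j.castSucc = W := by simp [o]
  have h₁ : o j.succ = W := by simp [o]
  refine ⟨⟨o, fun i => if h : i = j then
    eqToHom (by subst h; rw [h₀, h₁]) else 0, 0⟩, eqToIso h₀, eqToIso h₁, ?_, ?_⟩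
  · simp
  · intro i hi hi'
    simpa [o, hi, hi'] using hO

/-! The beginning `A_0 ⟶ A_1 ⟶ A_2` and the end `A_{n+1} ⟶ S A_0` of a sequence. -/

namespace AngleSeq

variable {m : ℕ} (A : AngleSeq S (m + 1))

def fst : C := A.obj (Fin.castSucc 0)

def snd : C := A.obj (Fin.succ 0)

def thd : C := A.obj (Fin.succ (Fin.succ 0))

def fin : C := A.obj (Fin.last (m + 2))

def fstMap : A.fst ⟶ A.snd := A.map 0

def sndMap : A.snd ⟶ A.thd := A.map (Fin.succ 0)

def finMap : A.fin ⟶ S.obj A.fst := A.last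

omit [HasFiniteBiproducts C] in
theorem IsLeftRotation.exists_iso {A B : AngleSeq S (m + 1)} (h : A.IsLeftRotation B) :
    ∃ (e₀ : B.fst ≅ A.snd) (e₁ : B.snd ≅ A.thd) (e' : B.fin ≅ S.obj A.fst),
      B.fstMap ≫ e₁.hom = e₀.hom ≫ A.sndMap ∧
      B.finMap ≫ S.map e₀.hom = e'.hom ≫ ((-1 : ℤ) ^ (m + 1) • S.map A.fstMap) := by
  obtain ⟨e, e', h1, -, h2⟩ := h
  exact ⟨e (Fin.castSucc 0), e (Fin.succ 0), e', h1 0, h2⟩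

end AngleSeq

variable {m : ℕ} (𝒜 : Angulation S (m + 1))

theorem Angulation.exists_extension {A B : AngleSeq S (m + 1)} (hA : 𝒜.IsAngle A)
    (hB : 𝒜.IsAngle B) (f₀ : A.fst ⟶ B.fst) (f₁ : A.snd ⟶ B.snd)
    (h : A.fstMap ≫ f₁ = f₀ ≫ B.fstMap) :
    ∃ (f₂ : A.thd ⟶ B.thd) (f' : A.fin ⟶ B.fin), A.sndMap ≫ f₂ = f₁ ≫ B.sndMap ∧
      A.finMap ≫ S.map f₀ = f' ≫ B.finMap := by
  obtain ⟨φ, rfl, rfl, -⟩ := 𝒜.complete A B hA hB f₀ f₁ h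
  exact ⟨φ.app _, φ.app _, φ.comm (Fin.succ 0), φ.comm_last⟩

theorem Angulation.exists_trivial (W : C) :
    ∃ (A : AngleSeq S (m + 1)) (e₀ : A.fst ≅ W) (e₁ : A.snd ≅ W),
      𝒜.IsAngle A ∧ A.fstMap ≫ e₁.hom = e₀.hom ∧ IsZero A.thd := by
  obtain ⟨A, (e₀ : A.fst ≅ W), (e₁ : A.snd ≅ W), (h : A.fstMap ≫ e₁.hom = e₀.hom), hz⟩ :=
    exists_seq_pair S (m + 1) 0 W
  have hz' : ∀ i : Fin (m + 3), 2 ≤ i.val → IsZero (A.obj i) := fun i hi =>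
    hz i (by rintro rfl; simp at hi) (by rintro rfl; simp at hi)
  have h' : A.fstMap = e₀.hom ≫ inv e₁.hom := (IsIso.eq_comp_inv _).2 h
  have : IsIso A.fstMap := by rw [h']; infer_instance
  exact ⟨A, e₀, e₁, 𝒜.trivial A this hz', h,
    hz' (Fin.succ (Fin.succ 0)) (by simp only [Fin.val_succ]; omega)⟩

/-- The sequence `0 ⟶ W = W ⟶ 0 ⟶ ⋯` is an angle because its left rotation is a trivial one. -/
theorem Angulation.exists_shifted_trivial [S.Additive] (W : C) :
    ∃ (A : AngleSeq S (m + 1)) (e₁ : A.snd ≅ W) (e₂ : A.thd ≅ W),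
      𝒜.IsAngle A ∧ A.sndMap ≫ e₂.hom = e₁.hom ∧ IsZero A.fst := by
  obtain ⟨A, (e₀ : A.snd ≅ W), (e₁ : A.thd ≅ W), (h : A.sndMap ≫ e₁.hom = e₀.hom), hz⟩ :=
    exists_seq_pair S (m + 1) (Fin.succ 0) W
  obtain ⟨B, hB⟩ := A.exists_isLeftRotation
  have hA0 : IsZero A.fst := hz (Fin.castSucc 0)
    (fun h => absurd (congrArg Fin.val h) (by simp))
    (fun h => absurd (congrArg Fin.val h) (by simp only [Fin.val_succ, Fin.val_castSucc]; simp))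
  refine ⟨A, e₀, e₁, (𝒜.rotate_iff A B hB).2 (𝒜.trivial B ?_ ?_), h, hA0⟩
  · obtain ⟨b₀, b₁, -, hb, -⟩ := hB.exists_iso
    have h3 : A.sndMap = e₀.hom ≫ inv e₁.hom := (IsIso.eq_comp_inv _).2 h
    have h4 : B.fstMap = (b₀.hom ≫ A.sndMap) ≫ inv b₁.hom := (IsIso.eq_comp_inv _).2 hb
    change IsIso B.fstMap
    rw [h4, h3]
    infer_instance
  · obtain ⟨e, e', -, -, -⟩ := hB
    intro i hi
    induction i using Fin.lastCases with
    | last => exact (S.map_isZero hA0).of_iso e'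
    | cast i =>
      refine (hz i.succ (fun h => ?_) (fun h => ?_)).of_iso (e i)
      all_goals
        have := congrArg Fin.val h
        simp only [Fin.val_succ, Fin.val_castSucc, Fin.val_zero] at this hi
        omega

theorem Angulation.exists_rotation {A : AngleSeq S (m + 1)} (hA : 𝒜.IsAngle A) :
    ∃ (B : AngleSeq S (m + 1)) (e₀ : B.fst ≅ A.snd) (e₁ : B.snd ≅ A.thd) (e' : B.fin ≅ S.obj A.fst),
      𝒜.IsAngle B ∧ B.fstMap ≫ e₁.hom = e₀.hom ≫ A.sndMap ∧
      B.finMap ≫ S.map e₀.hom = e'.hom ≫ ((-1 : ℤ) ^ (m + 1) • S.map A.fstMap) := by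
  obtain ⟨B, hB⟩ := A.exists_isLeftRotation
  obtain ⟨e₀, e₁, e', h, h'⟩ := hB.exists_iso
  exact ⟨B, e₀, e₁, e', (𝒜.rotate_iff A B hB).1 hA, h, h'⟩

end Exactness

section

variable {C : Type u} [Category.{v} C] [Preadditive C] {S : C ⥤ C} [S.IsEquivalence] [S.Additive]

theorem WeakExact.map {X Y Z : C} {f : X ⟶ Y} {g : Y ⟶ Z} (h : WeakExact f g) :
    WeakExact (S.map f) (S.map g) := by
  refine ⟨by rw [← S.map_comp, h.zero, S.map_zero], fun {W} t ht => ?_, fun {W} t ht => ?_⟩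
  · let e := S.objObjPreimageIso W
    obtain ⟨t', ht'⟩ := h.lift (S.preimage (e.hom ≫ t)) (S.map_injective (by simp [ht]))
    refine ⟨e.inv ≫ S.map t', ?_⟩
    rw [Category.assoc, ← S.map_comp, ht']
    simp
  · let e := S.objObjPreimageIso W
    obtain ⟨t', ht'⟩ := h.desc (S.preimage (t ≫ e.inv)) (S.map_injective (by simp [reassoc_of% ht]))
    refine ⟨S.map t' ≫ e.hom, ?_⟩
    rw [← Category.assoc, ← S.map_comp, ht']
    simp

variable [HasFiniteBiproducts C] {m : ℕ} {𝒜 : Angulation S (m + 1)}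

theorem Angulation.weakExact_fst {A : AngleSeq S (m + 1)} (hA : 𝒜.IsAngle A) :
    WeakExact A.fstMap A.sndMap := by
  refine ⟨?_, fun {W} g hg => ?_, fun {W} g hg => ?_⟩
  -- Comparing with the trivial angle on `A.fst`, the composite factors through its third object,
  -- which is zero.
  · obtain ⟨B, e₀, e₁, hB, h, hz⟩ := 𝒜.exists_trivial A.fst
    obtain ⟨f₂, -, h2, -⟩ := 𝒜.exists_extension hB hA e₀.hom (e₁.hom ≫ A.fstMap)
      (by rw [← Category.assoc, h])
    rw [hz.eq_of_src f₂ 0, comp_zero, Category.assoc] at h2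
    exact (cancel_epi e₁.hom).1 (h2.symm.trans comp_zero.symm)
  -- The lift goes backwards, so rotate both angles: `g` starts a morphism from the rotated trivial
  -- angle on `W`. Its last component is a map `S W ⟶ S A.fst` up to isomorphism, and fullness of
  -- `S` desuspends it. The signs of the two rotations cancel.
  · obtain ⟨B, t₀, t₁, hB, ht, hz⟩ := 𝒜.exists_trivial W
    obtain ⟨B', b₀, b₁, b', hB', -, hbl⟩ := 𝒜.exists_rotation hB
    obtain ⟨A', a₀, a₁, a', hA', ha, hal⟩ := 𝒜.exists_rotation hA
    have ha' : A'.fstMap = a₀.hom ≫ A.sndMap ≫ a₁.inv := by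
      rw [← Category.assoc, ← ha]; simp
    obtain ⟨-, f', -, hl⟩ := 𝒜.exists_extension hB' hA' (b₀.hom ≫ t₁.hom ≫ g ≫ a₀.inv) 0 (by
      rw [ha']; simp [reassoc_of% hg])
    have hl2 : b'.hom ≫ S.map (B.fstMap ≫ t₁.hom ≫ g) = f' ≫ a'.hom ≫ S.map A.fstMap := by
      rw [S.map_comp b₀.hom, reassoc_of% hbl] at hl
      have := congrArg (fun t => (-1 : ℤ) ^ (m + 1) • (t ≫ S.map a₀.hom)) hl
      simp only [Category.assoc, hal] at this
      simpa [smul_smul, ← mul_pow, ← S.map_comp, -Functor.map_comp] using this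
    rw [← Category.assoc B.fstMap, ht, S.map_comp] at hl2
    refine ⟨S.preimage (S.map t₀.inv ≫ b'.inv ≫ f' ≫ a'.hom), S.map_injective ?_⟩
    rw [S.map_comp, S.map_preimage]
    simp only [Category.assoc]
    rw [← hl2]
    simp [← S.map_comp_assoc]
  -- Here `g` extends to a morphism from `A` to `0 ⟶ W = W ⟶ 0 ⟶ ⋯`, whose third component is the
  -- factorization.
  · obtain ⟨B, e₁, e₂, hB, h, hz⟩ := 𝒜.exists_shifted_trivial W
    obtain ⟨f₂, -, h2, -⟩ := 𝒜.exists_extension hA hB 0 (g ≫ e₁.inv) (by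
      rw [reassoc_of% hg]; simp)
    refine ⟨f₂ ≫ e₂.hom, ?_⟩
    rw [← Category.assoc, h2, Category.assoc, h]
    simp

/-- Rotation moves each position down to the first one. -/
theorem Angulation.weakExact {A : AngleSeq S (m + 1)} (hA : 𝒜.IsAngle A) (i : Fin (m + 1)) :
    WeakExact (A.map i.castSucc) (A.map i.succ) := by
  induction i using Fin.induction generalizing A with
  | zero => exact weakExact_fst hA
  | succ i ih =>
    obtain ⟨B, hB⟩ := A.exists_isLeftRotation
    have hB' := (𝒜.rotate_iff A B hB).1 hA
    obtain ⟨b, b', hb, -, -⟩ := hB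
    exact (ih hB').of_iso (b i.castSucc.castSucc) (b i.castSucc.succ) (b i.succ.succ)
      (hb i.castSucc) (hb i.succ)

theorem Angulation.weakExact_last {A : AngleSeq S (m + 1)} (hA : 𝒜.IsAngle A) :
    WeakExact (A.map (Fin.last (m + 1))) A.last := by
  obtain ⟨B, hB⟩ := A.exists_isLeftRotation
  have hB' := (𝒜.rotate_iff A B hB).1 hA
  obtain ⟨b, b', hb, hbl, -⟩ := hB
  exact (weakExact hB' (Fin.last m)).of_iso (b (Fin.last m).castSucc) (b (Fin.last m).succ) b'
    (hb (Fin.last m)) hbl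

theorem Angulation.weakExact_last_map {A : AngleSeq S (m + 1)} (hA : 𝒜.IsAngle A) :
    WeakExact A.last (S.map (A.map 0)) := by
  obtain ⟨B, hB⟩ := A.exists_isLeftRotation
  have hB' := (𝒜.rotate_iff A B hB).1 hA
  obtain ⟨b, b', hb, hbl, hbl'⟩ := hB
  exact ((weakExact_last hB').of_iso (b _) b' (S.mapIso (b 0)) hbl hbl').of_unit_smul

end

end HigherAngulated

namespace HigherAR

/-! ### Summands of powers of a module -/

section

variable {R : Type v} [Ring R]

theorem addMod.exists_sum {M N : FGModuleCat.{v} R} (h : addMod M N) :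
    ∃ (m : ℕ) (i : Fin m → N →ₗ[R] M) (r : Fin m → M →ₗ[R] N), ∀ x, ∑ j, r j (i j x) = x := by
  obtain ⟨m, Y, ⟨e⟩⟩ := h
  refine ⟨m, fun j => LinearMap.proj j ∘ₗ e.toLinearMap ∘ₗ LinearMap.inl R N Y,
    fun j => LinearMap.fst R N Y ∘ₗ e.symm.toLinearMap ∘ₗ LinearMap.single R (fun _ => M) j,
    fun x => ?_⟩
  simp only [LinearMap.comp_apply, ← map_sum]
  have : ∑ j, (LinearMap.single R (fun _ : Fin m => (M : Type v)) j)
      ((LinearMap.proj j : (Fin m → M) →ₗ[R] M) (e (LinearMap.inl R N Y x))) =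
      e (LinearMap.inl R N Y x) := by
    ext j
    simp [Finset.sum_apply, Pi.single_apply]
  refine Eq.trans (congrArg (fun t => LinearMap.fst R N Y (e.symm t)) this) ?_
  simp

theorem addMod_of_sum [IsNoetherianRing R] {M N : FGModuleCat.{v} R} {m : ℕ}
    (i : Fin m → N →ₗ[R] M) (r : Fin m → M →ₗ[R] N) (h : ∀ x, ∑ j, r j (i j x) = x) :
    addMod M N := by
  let s : N →ₗ[R] (Fin m → M) := LinearMap.pi i
  let p : (Fin m → M) →ₗ[R] N := ∑ j, r j ∘ₗ LinearMap.proj j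
  have hps : ∀ x, p (s x) = x := fun x => by
    simpa [p, s, LinearMap.sum_apply] using h x
  let q : (Fin m → M) →ₗ[R] LinearMap.ker p :=
    (LinearMap.id - s ∘ₗ p).codRestrict _ fun x => by simp [hps]
  refine ⟨m, FGModuleCat.of R (LinearMap.ker p), ⟨LinearEquiv.symm (LinearEquiv.ofLinearMap
    (p.prod q) (s.coprod (LinearMap.ker p).subtype) ?_ ?_)⟩⟩
  · ext x
    · simp [hps]
    · simp [q, hps]
    · simp
    · simp [q]
  · refine LinearMap.ext fun x => ?_
    simp [q]

theorem addMod.of_equiv {M M' N N' : FGModuleCat.{v} R} (e : M ≃ₗ[R] M') (e' : N ≃ₗ[R] N')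
    (h : addMod M N) : addMod M' N' := by
  obtain ⟨m, Y, ⟨f⟩⟩ := h
  exact ⟨m, Y, ⟨(e'.symm.prodCongr (LinearEquiv.refl R Y)).trans
    (f.trans (LinearEquiv.piCongrRight fun _ => e))⟩⟩

theorem ModHomZero.of_equiv {M M' N N' : FGModuleCat.{v} R} (e : M ≃ₗ[R] M') (e' : N ≃ₗ[R] N')
    (h : ModHomZero M N) : ModHomZero M' N' := by
  intro f
  have := h (e'.symm.toLinearMap ∘ₗ f ∘ₗ e.toLinearMap)
  ext x
  have := LinearMap.congr_fun this (e.symm x)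
  simpa using this

end

end HigherAR

namespace HigherAngulated

open HigherAR

/-! ### The functor `C(T, -)` -/

section HomFunctor

variable (k : Type w) [Field k] {C : Type u} [Category.{v} C] [Preadditive C] [Linear k C]
  [∀ X Y : C, Module.Finite k (X ⟶ Y)] (T : C)

/-- The right `End T`-module `C(T, X)`. -/
abbrev homObj (X : C) : FGModuleCat.{v} (End T)ᵐᵒᵖ := (homFunctor k T).obj X

variable {T} in
/-- The elements of `C(T, X)` are the morphisms `T ⟶ X`. -/
def toHom {X : C} : homObj k T X ≃+ (T ⟶ X) := AddEquiv.refl (T ⟶ X)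

/-- The `End T`-linear map induced by a morphism. -/
def homMap {X Y : C} (f : X ⟶ Y) : homObj k T X →ₗ[(End T)ᵐᵒᵖ] homObj k T Y :=
  ((homFunctor k T).map f).hom.hom

include k in
theorem noetherian_end : IsNoetherianRing (End T)ᵐᵒᵖ := IsNoetherianRing.of_finite k _

include k in
theorem artinian_end : IsArtinianRing (End T)ᵐᵒᵖ := IsArtinianRing.of_finite k _

variable {T}

@[simp]
theorem toHom_homMap {X Y : C} (f : X ⟶ Y) (x : homObj k T X) :
    toHom k (homMap k T f x) = toHom k x ≫ f := rfl

@[simp]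
theorem toHom_smul {X : C} (r : (End T)ᵐᵒᵖ) (x : homObj k T X) :
    toHom k (r • x) = r.unop ≫ toHom k x := rfl

theorem homMap_comp {X Y Z : C} (f : X ⟶ Y) (g : Y ⟶ Z) :
    homMap k T (f ≫ g) = homMap k T g ∘ₗ homMap k T f := by
  refine LinearMap.ext fun x => (toHom k).injective ?_
  simp

theorem homMap_eq_iff {X Y : C} (f g : X ⟶ Y) :
    homMap k T f = homMap k T g ↔ ∀ t : T ⟶ X, t ≫ f = t ≫ g :=
  ⟨fun h t => congrArg (toHom k) (LinearMap.congr_fun h ((toHom k).symm t)),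
    fun h => LinearMap.ext fun x => (toHom k).injective (h (toHom k x))⟩

/-- Isomorphic objects have isomorphic images. -/
def homEquivOfIso {X Y : C} (e : X ≅ Y) : homObj k T X ≃ₗ[(End T)ᵐᵒᵖ] homObj k T Y :=
  FGModuleCat.isoToLinearEquiv ((homFunctor k T).mapIso e)

variable [HasFiniteBiproducts C]

/-- `C(T, -)` preserves binary direct sums. -/
def homBiprodEquiv (X Y : C) :
    homObj k T (X ⊞ Y) ≃ₗ[(End T)ᵐᵒᵖ] (homObj k T X × homObj k T Y) :=
  LinearEquiv.ofLinearMap ((homMap k T biprod.fst).prod (homMap k T biprod.snd))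
    ((homMap k T biprod.inl).coprod (homMap k T biprod.inr)) (by
      ext x
      all_goals refine (toHom k).injective ?_
      all_goals simp) (by
      refine LinearMap.ext fun x => (toHom k).injective ?_
      rw [LinearMap.comp_apply, LinearMap.coprod_apply, map_add]
      change (toHom k x ≫ biprod.fst) ≫ biprod.inl + (toHom k x ≫ biprod.snd) ≫ biprod.inr =
        toHom k x
      rw [Category.assoc, Category.assoc, ← Preadditive.comp_add, biprod.total, Category.comp_id])

theorem eq_of_forall_comp {U Y : C} (hU : add T U) {f g : U ⟶ Y}
    (h : ∀ t : T ⟶ U, t ≫ f = t ≫ g) : f = g := by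
  obtain ⟨m, p, q, hpq⟩ := hU.exists_sum
  rw [← Category.id_comp f, ← Category.id_comp g, ← hpq, Preadditive.sum_comp, Preadditive.sum_comp]
  simp only [Category.assoc, h]

theorem HomZero.of_add {T' U Y : C} (hU : add T' U) (h : HomZero T' Y) : HomZero U Y := by
  intro f
  obtain ⟨m, p, q, hpq⟩ := hU.exists_sum
  rw [← Category.id_comp f, ← hpq, Preadditive.sum_comp]
  exact Finset.sum_eq_zero fun i _ => by rw [Category.assoc, h (q i ≫ f), comp_zero]

theorem HomZero.of_add_right {T' U Y : C} (hU : add T' U) (h : HomZero Y T') : HomZero Y U := by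
  intro f
  obtain ⟨m, p, q, hpq⟩ := hU.exists_sum
  rw [← Category.comp_id f, ← hpq, Preadditive.comp_sum]
  exact Finset.sum_eq_zero fun i _ => by rw [← Category.assoc, h (f ≫ p i), zero_comp]

/-- Yoneda for `T`: the map is determined by the images of the `q i`, because every `x : T ⟶ U`
equals the combination of the `q i` with coefficients `x ≫ p i`. -/
theorem exists_homMap_eq_of_add {U Y : C} (hU : add T U)
    (φ : homObj k T U →ₗ[(End T)ᵐᵒᵖ] homObj k T Y) : ∃ f : U ⟶ Y, homMap k T f = φ := by
  obtain ⟨m, p, q, hpq⟩ := hU.exists_sum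
  refine ⟨∑ i, p i ≫ toHom k (φ ((toHom k).symm (q i))), ?_⟩
  refine LinearMap.ext fun x => (toHom k).injective ?_
  have hx : x = ∑ i, MulOpposite.op (show End T from toHom k x ≫ p i) • (toHom k).symm (q i) := by
    refine (toHom k).injective ?_
    rw [map_sum]
    have := congrArg (fun t => toHom k x ≫ t) hpq
    rw [Preadditive.comp_sum, Category.comp_id] at this
    exact this.symm.trans (Finset.sum_congr rfl fun i _ => (Category.assoc _ _ _).symm)
  conv_rhs => rw [hx, map_sum, map_sum]
  simp only [map_smul, toHom_smul, MulOpposite.unop_op, toHom_homMap, Preadditive.comp_sum]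
  simp

theorem projective_homObj {U : C} (hU : add T U) :
    Module.Projective (End T)ᵐᵒᵖ (homObj k T U) := by
  obtain ⟨m, p, q, hpq⟩ := hU.exists_sum
  let s : homObj k T U →ₗ[(End T)ᵐᵒᵖ] (Fin m → (End T)ᵐᵒᵖ) := LinearMap.pi fun i =>
    { toFun := fun x => MulOpposite.op (show End T from toHom k x ≫ p i)
      map_add' := fun x y => MulOpposite.unop_injective (by
        simp only [MulOpposite.unop_add, MulOpposite.unop_op, map_add]
        exact Preadditive.add_comp _ _ _ _ _ _)
      map_smul' := fun r x => MulOpposite.unop_injective (by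
        simp only [MulOpposite.unop_op, toHom_smul, RingHom.id_apply, smul_eq_mul,
          MulOpposite.unop_mul]
        exact Category.assoc _ _ _) }
  let r : (Fin m → (End T)ᵐᵒᵖ) →ₗ[(End T)ᵐᵒᵖ] homObj k T U :=
    ∑ i, LinearMap.toSpanSingleton _ _ ((toHom k).symm (q i)) ∘ₗ LinearMap.proj i
  refine Module.Projective.of_split s r (LinearMap.ext fun x => (toHom k).injective ?_)
  simp only [r, s, LinearMap.comp_apply, LinearMap.sum_apply, map_sum, LinearMap.proj_apply,
    LinearMap.toSpanSingleton_apply, toHom_smul, AddEquiv.apply_symm_apply, LinearMap.id_apply]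
  refine Eq.trans ?_ ((congrArg (fun t => toHom k x ≫ t) hpq).trans (Category.comp_id _))
  rw [Preadditive.comp_sum]
  exact Finset.sum_congr rfl fun i _ => Category.assoc _ _ _

theorem modHomZero_iff {U Y : C} (hU : add T U) :
    ModHomZero (homObj k T U) (homObj k T Y) ↔ HomZero U Y := by
  constructor
  · intro h f
    exact eq_of_forall_comp hU fun t => by
      have := (h (homMap k T f)).trans (h (homMap k T 0)).symm
      exact (homMap_eq_iff k f 0).1 this t
  · intro h φ
    obtain ⟨f, rfl⟩ := exists_homMap_eq_of_add k hU φ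
    rw [h f]
    exact LinearMap.ext fun x => (toHom k).injective (by simp)

variable [IsIdempotentComplete C]

/-- `Q` is the image of an idempotent of `C(T, T^m)`. By full faithfulness on `add T` the idempotent
comes from `T^m`, where it splits. -/
theorem exists_equiv_homObj_of_projective (Q : FGModuleCat.{v} (End T)ᵐᵒᵖ)
    [Module.Projective (End T)ᵐᵒᵖ Q] :
    ∃ U, add T U ∧ Nonempty (homObj k T U ≃ₗ[(End T)ᵐᵒᵖ] Q) := by
  obtain ⟨m, p, f, hpf⟩ := exists_dual_basis (End T)ᵐᵒᵖ Q
  let B : C := ⨁ fun _ : Fin m => T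
  have hB : add T B := add_biproduct T
  let s : Q →ₗ[(End T)ᵐᵒᵖ] homObj k T B :=
    { toFun := fun x => (toHom k).symm (biproduct.lift fun i => (f i x).unop)
      map_add' := fun x y => (toHom k).injective (by
        rw [map_add]
        simp only [AddEquiv.apply_symm_apply]
        ext i
        simp)
      map_smul' := fun r x => (toHom k).injective (by
        rw [RingHom.id_apply, toHom_smul]
        simp only [AddEquiv.apply_symm_apply]
        ext i
        simp) }
  let r : homObj k T B →ₗ[(End T)ᵐᵒᵖ] Q :=
    { toFun := fun x => ∑ i, MulOpposite.op (show End T from toHom k x ≫ biproduct.π _ i) • p i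
      map_add' := fun x y => by
        rw [← Finset.sum_add_distrib]
        refine Finset.sum_congr rfl fun i _ => ?_
        rw [← add_smul]
        congr 1
        refine MulOpposite.unop_injective ?_
        exact (congrArg (fun t => t ≫ _) (map_add (toHom k) x y)).trans
          (Preadditive.add_comp _ _ _ _ _ _)
      map_smul' := fun a x => by
        rw [RingHom.id_apply, Finset.smul_sum]
        refine Finset.sum_congr rfl fun i _ => ?_
        rw [← mul_smul]
        congr 1
        refine MulOpposite.unop_injective ?_
        exact Category.assoc _ _ _ }
  have hrs : ∀ x, r (s x) = x := fun x => by
    conv_rhs => rw [← hpf x]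
    change ∑ i, _ • p i = _
    refine Finset.sum_congr rfl fun i _ => ?_
    congr 1
    refine MulOpposite.unop_injective ?_
    exact biproduct.lift_π _ _
  obtain ⟨ε, hε⟩ := exists_homMap_eq_of_add k hB (s ∘ₗ r)
  have hidem : ε ≫ ε = ε := eq_of_forall_comp hB ((homMap_eq_iff k _ _).1 (by
    rw [homMap_comp, hε]
    refine LinearMap.ext fun x => ?_
    simp [hrs]))
  obtain ⟨U, i, q, hiq, hqi⟩ := IsIdempotentComplete.idempotents_split B ε hidem
  refine ⟨U, (add_of_retract i q hiq).trans hB, ⟨LinearEquiv.ofLinearMap (r ∘ₗ homMap k T i)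
    (homMap k T q ∘ₗ s) ?_ ?_⟩⟩
  · refine LinearMap.ext fun x => ?_
    have h1 : homMap k T i (homMap k T q (s x)) = s (r (s x)) := by
      rw [← LinearMap.comp_apply, ← homMap_comp, hqi, hε]; rfl
    simp only [LinearMap.comp_apply, h1, hrs, LinearMap.id_apply]
  · refine LinearMap.ext fun x => (toHom k).injective ?_
    have h1 : s (r (homMap k T i x)) = homMap k T ε (homMap k T i x) := by rw [hε]; rfl
    simp only [LinearMap.comp_apply, h1, toHom_homMap, LinearMap.id_apply, ← hqi, Category.assoc,
      hiq, reassoc_of% hiq, Category.comp_id]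

omit [IsIdempotentComplete C] in
theorem addMod_of_add {M N : C} (h : add M N) : addMod (homObj k T M) (homObj k T N) := by
  have := noetherian_end k T
  obtain ⟨m, p, q, hpq⟩ := h.exists_sum
  refine addMod_of_sum (fun j => homMap k T (p j)) (fun j => homMap k T (q j)) fun x =>
    (toHom k).injective ?_
  rw [map_sum]
  simp only [toHom_homMap, Category.assoc, ← Preadditive.comp_sum, hpq, Category.comp_id]

theorem add_of_addMod {U V : C} (hU : add T U) (hV : add T V)
    (h : addMod (homObj k T U) (homObj k T V)) : add U V := by
  obtain ⟨m, i, r, hir⟩ := h.exists_sum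
  choose p hp using fun j => exists_homMap_eq_of_add k hV (i j)
  choose q hq using fun j => exists_homMap_eq_of_add k hU (r j)
  refine add_of_sum p q (eq_of_forall_comp hV fun t => ?_)
  have := congrArg (toHom k) (hir ((toHom k).symm t))
  simp only [← hp, ← hq, map_sum, toHom_homMap, AddEquiv.apply_symm_apply] at this
  rw [Preadditive.comp_sum, Category.comp_id]
  exact Eq.trans (Finset.sum_congr rfl fun i _ => (Category.assoc _ _ _).symm) this

end HomFunctor

end HigherAngulated

namespace HigherAngulated

open HigherAR

/-! ### Cluster tilting objects -/

section ClusterTilting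

theorem HomZero.of_iso {C : Type u} [Category.{v} C] [Preadditive C] {X X' Y Y' : C} (e : X ≅ X') (e' : Y ≅ Y') (h : HomZero X Y) :
    HomZero X' Y' := fun f => by
  have := h (e.hom ≫ f ≫ e'.inv)
  rw [← cancel_epi e.hom, ← cancel_mono e'.inv, Category.assoc, this]
  simp

variable (k : Type w) [Field k] {C : Type u} [Category.{v} C] [Preadditive C] [Linear k C]
  [HasFiniteBiproducts C] [∀ X Y : C, Module.Finite k (X ⟶ Y)] {S : C ⥤ C} {T : C} {m : ℕ}
  {𝒜 : Angulation S (m + 1)}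

theorem homZero_of_add_of_add [S.Additive] (hT : HomZero T (S.obj T)) {U V : C} (hU : add T U)
    (hV : add T V) : HomZero U (S.obj V) := by
  refine HomZero.of_add hU fun f => ?_
  obtain ⟨l, p, q, hpq⟩ := hV.exists_sum
  have : ∑ i, S.map (p i) ≫ S.map (q i) = 𝟙 (S.obj V) := by
    simp only [← S.map_comp, ← S.map_sum, hpq, S.map_id]
  rw [← Category.comp_id f, ← this, Preadditive.comp_sum]
  exact Finset.sum_eq_zero fun i _ => by rw [← Category.assoc, hT (f ≫ S.map (p i)), zero_comp]

variable [IsIdempotentComplete C] [S.IsEquivalence] [S.Additive]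

omit [IsIdempotentComplete C] in
/-- Every object has a presentation `U₁ ⟶ U₀ ⟶ X ⟶ S U` by objects of `add T`. -/
theorem IsClusterTilting.exists_presentation (hT : IsClusterTilting 𝒜 T) (X : C) :
    ∃ (U₁ U₀ U : C) (b : U₁ ⟶ U₀) (a : U₀ ⟶ X) (c : X ⟶ S.obj U), add T U₁ ∧ add T U₀ ∧ add T U ∧
      WeakExact b a ∧ WeakExact a c := by
  obtain ⟨A, hA, hadd, ⟨e⟩⟩ := hT.2 X
  have h1 := (Angulation.weakExact hA (Fin.last m)).of_iso (Iso.refl _) (Iso.refl _) e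
    (f' := A.map (Fin.last m).castSucc) (g' := A.map (Fin.last (m + 1)) ≫ e.hom)
    (by simp) (by rw [Iso.refl_hom, Category.id_comp]; rfl)
  have h2 := (Angulation.weakExact_last hA).of_iso (Iso.refl _) e (Iso.refl _)
    (f' := A.map (Fin.last (m + 1)) ≫ e.hom) (g' := e.inv ≫ A.last)
    (by simp) (by simp)
  exact ⟨_, _, _, _, _, _, hadd _, hadd (Fin.last (m + 1)), hadd 0, h1, h2⟩

/-- Lift `φ` to the cover `U₀` of the presentation; the lift kills `U₁` and so descends to `X`. It
induces `φ` because every `T ⟶ X` factors through `U₀`, as `C(T, S U) = 0`. -/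
theorem IsClusterTilting.exists_homMap_eq (hT : IsClusterTilting 𝒜 T) {X Y : C}
    (φ : homObj k T X →ₗ[(End T)ᵐᵒᵖ] homObj k T Y) : ∃ f : X ⟶ Y, homMap k T f = φ := by
  obtain ⟨U₁, U₀, U, b, a, c, hU₁, hU₀, hU, hba, hac⟩ := hT.exists_presentation X
  obtain ⟨g, hg⟩ := exists_homMap_eq_of_add k hU₀ (φ ∘ₗ homMap k T a)
  have hbg : b ≫ g = 0 := eq_of_forall_comp hU₁ ((homMap_eq_iff k _ _).1 (by
    rw [homMap_comp, hg, LinearMap.comp_assoc, ← homMap_comp, hba.zero]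
    refine LinearMap.ext fun x => (toHom k).injective ?_
    have : homMap k T (0 : U₁ ⟶ X) x = 0 := (toHom k).injective (by simp)
    simp [this]))
  obtain ⟨f, hf⟩ := hba.desc g hbg
  refine ⟨f, LinearMap.ext fun x => (toHom k).injective ?_⟩
  obtain ⟨y, hy⟩ := hac.lift (toHom k x) (homZero_of_add_of_add hT.1 (add_self T) hU _)
  have hx : x = homMap k T a ((toHom k).symm y) := (toHom k).injective (by simp [hy])
  rw [hx, ← LinearMap.comp_apply φ, ← hg, ← hf]
  simp

omit [IsIdempotentComplete C] in
theorem IsClusterTilting.exists_factorization (hT : IsClusterTilting 𝒜 T) {X Y : C} (f : X ⟶ Y)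
    (hf : ∀ t : T ⟶ X, t ≫ f = 0) :
    ∃ (U : C) (p : X ⟶ S.obj U) (q : S.obj U ⟶ Y), add T U ∧ p ≫ q = f := by
  obtain ⟨U₁, U₀, U, b, a, c, hU₁, hU₀, hU, hba, hac⟩ := hT.exists_presentation X
  obtain ⟨q, hq⟩ := hac.desc f (eq_of_forall_comp hU₀ fun t => by
    rw [← Category.assoc, hf, comp_zero])
  exact ⟨U, c, q, hU, hq⟩

omit [S.IsEquivalence] in
theorem add_map {X Y : C} (h : add X Y) : add (S.obj X) (S.obj Y) := by
  obtain ⟨l, p, q, hpq⟩ := h.exists_sum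
  refine add_of_sum (fun i => S.map (p i)) (fun i => S.map (q i)) ?_
  simp only [← S.map_comp, ← S.map_sum, hpq, S.map_id]

theorem add_map_iff {X Y : C} : add (S.obj X) (S.obj Y) ↔ add X Y := by
  refine ⟨fun h => ?_, add_map⟩
  obtain ⟨l, p, q, hpq⟩ := h.exists_sum
  refine add_of_sum (fun i => S.preimage (p i)) (fun i => S.preimage (q i)) (S.map_injective ?_)
  simp only [S.map_comp, S.map_sum, S.map_preimage, hpq, S.map_id]

theorem exists_iso_map_of_add {V : C} (h : add (S.obj T) V) :
    ∃ U, add T U ∧ Nonempty (V ≅ S.obj U) := by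
  let e := S.objObjPreimageIso V
  exact ⟨S.objPreimage V, add_map_iff.1 ((add_of_iso e).trans h), ⟨e.symm⟩⟩

-- The difference `1 - f` is killed by `C(T, -)`, so it factors through `add (S T)` and is radical.
include k in
theorem HasNoSummandInAdd.isIso_of_forall {M : C} (hT : IsClusterTilting 𝒜 T)
    (hM : HasNoSummandInAdd M (S.obj T)) (f : M ⟶ M) (hf : ∀ t : T ⟶ M, t ≫ f = t) : IsIso f := by
  obtain ⟨U, p, q, hU, hpq⟩ := hT.exists_factorization (𝟙 M - f) (fun t => by
    rw [Preadditive.comp_sub, hf, Category.comp_id, sub_self])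
  have := hM.radicalThrough_add k (add_map hU) p q
  rwa [hpq, sub_sub_cancel] at this

theorem HasNoSummandInAdd.nonempty_iso {M M' : C} (hT : IsClusterTilting 𝒜 T)
    (hM : HasNoSummandInAdd M (S.obj T)) (hM' : HasNoSummandInAdd M' (S.obj T))
    (e : homObj k T M ≃ₗ[(End T)ᵐᵒᵖ] homObj k T M') : Nonempty (M ≅ M') := by
  obtain ⟨f, hf⟩ := hT.exists_homMap_eq k e.toLinearMap
  obtain ⟨g, hg⟩ := hT.exists_homMap_eq k e.symm.toLinearMap
  have h1 : IsIso (f ≫ g) := hM.isIso_of_forall k hT _ fun t => by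
    have := congrArg (toHom k) (e.symm_apply_apply ((toHom k).symm t))
    rw [← LinearEquiv.coe_coe, ← LinearEquiv.coe_coe, ← hf, ← hg] at this
    simpa using this
  have h2 : IsIso (g ≫ f) := hM'.isIso_of_forall k hT _ fun t => by
    have := congrArg (toHom k) (e.apply_symm_apply ((toHom k).symm t))
    rw [← LinearEquiv.coe_coe, ← LinearEquiv.coe_coe, ← hf, ← hg] at this
    simpa using this
  have := isIso_of_isIso_comp f g h1 h2
  exact ⟨asIso f⟩

/-- Lifting the module maps gives an endomorphism of `N` that is the identity only after applying
`C(T, -)`; it is still invertible, and dividing by it gives membership in `add M`. -/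
theorem HasNoSummandInAdd.add_iff {M N : C} (hT : IsClusterTilting 𝒜 T)
    (hN : HasNoSummandInAdd N (S.obj T)) :
    add M N ↔ addMod (homObj k T M) (homObj k T N) := by
  refine ⟨addMod_of_add k, fun h => ?_⟩
  obtain ⟨l, i, r, hir⟩ := h.exists_sum
  choose p hp using fun j => hT.exists_homMap_eq k (i j)
  choose q hq using fun j => hT.exists_homMap_eq k (r j)
  have : IsIso (∑ j, p j ≫ q j) := hN.isIso_of_forall k hT _ fun t => by
    have := congrArg (toHom k) (hir ((toHom k).symm t))
    simp only [← hp, ← hq, map_sum, toHom_homMap, AddEquiv.apply_symm_apply] at this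
    rw [Preadditive.comp_sum]
    exact Eq.trans (Finset.sum_congr rfl fun i _ => (Category.assoc _ _ _).symm) this
  refine add_of_sum p (fun j => q j ≫ inv (∑ j, p j ≫ q j)) ?_
  refine Eq.trans ?_ (IsIso.hom_inv_id (∑ j, p j ≫ q j))
  rw [Preadditive.sum_comp]
  simp only [Category.assoc]

/-! ### Extensions computed from an angle -/

omit [HasFiniteBiproducts C] [S.IsEquivalence] [S.Additive] [IsIdempotentComplete C] in
theorem exact_range_homMap {X Y Z : C} {f : X ⟶ Y} {g : Y ⟶ Z} (h : WeakExact f g) :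
    Function.Exact (LinearMap.range (homMap k T f)).subtype (homMap k T g).rangeRestrict := by
  intro x
  rw [Submodule.coe_subtype, Subtype.range_coe]
  constructor
  · intro hx
    obtain ⟨y, hy⟩ := h.lift (toHom k x) (congrArg (fun t => toHom k t.1) hx)
    exact ⟨(toHom k).symm y, (toHom k).injective (by simpa using hy)⟩
  · rintro ⟨y, rfl⟩
    refine Subtype.ext ((toHom k).injective ?_)
    change (toHom k y ≫ f) ≫ g = 0
    rw [Category.assoc, h.zero, comp_zero]

-- Dimension shifting along the images of the angle: the image of `A_{i+1} ⟶ A_{i+2}` is an `i`-fold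
-- cosyzygy of that of `A_1 ⟶ A_2`, whose `Ext^1` is computed from the image of `A_0 ⟶ A_1`. Only
-- `A_1, …, A_{m+1}` need be in `add T`.
omit [IsIdempotentComplete C] in
theorem extZero_range_last_iff {A : AngleSeq S (m + 1)} (hA : 𝒜.IsAngle A)
    (hadd : ∀ i : Fin (m + 1), add T (A.obj i.succ.castSucc)) (X : Type v) [AddCommGroup X]
    [Module (End T)ᵐᵒᵖ X] (i : Fin (m + 1)) :
    ExtZero (End T)ᵐᵒᵖ (i.val + 1) (LinearMap.range (homMap k T (A.map i.succ))) X ↔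
      ∀ f : LinearMap.range (homMap k T A.fstMap) →ₗ[(End T)ᵐᵒᵖ] X,
        ∃ g : homObj k T A.snd →ₗ[(End T)ᵐᵒᵖ] X, g ∘ₗ Submodule.subtype _ = f := by
  induction i using Fin.induction with
  | zero =>
    have : Module.Projective (End T)ᵐᵒᵖ (homObj k T (A.obj (Fin.castSucc (0 : Fin (m + 1))).succ)) :=
      projective_homObj k (hadd 0)
    exact extZero_one_iff _ _ (Submodule.subtype_injective _) (LinearMap.surjective_rangeRestrict _)
      (exact_range_homMap k (Angulation.weakExact hA 0)) X
  | succ i ih =>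
    have : Module.Projective (End T)ᵐᵒᵖ (homObj k T (A.obj i.succ.castSucc.succ)) :=
      projective_homObj k (hadd i.succ)
    rw [← ih]
    exact extZero_succ_iff _ _ (Submodule.subtype_injective _) (LinearMap.surjective_rangeRestrict _)
      (exact_range_homMap k (Angulation.weakExact hA i.succ)) X i.val

end ClusterTilting

end HigherAngulated

namespace HigherAngulated

open HigherAR

/-! ### Additivity and Calabi–Yau symmetry of the vanishing of `C(X, S Y)` -/

section CalabiYau

variable {C : Type u} [Category.{v} C] [Preadditive C]

theorem homZero_biprod_left [HasFiniteBiproducts C] {X X' Y : C} :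
    HomZero (X ⊞ X') Y ↔ HomZero X Y ∧ HomZero X' Y := by
  refine ⟨fun h => ⟨fun f => ?_, fun f => ?_⟩, fun ⟨h, h'⟩ f => ?_⟩
  · rw [← biprod.inl_desc f (0 : X' ⟶ Y), h (biprod.desc f 0), comp_zero]
  · rw [← biprod.inr_desc (0 : X ⟶ Y) f, h (biprod.desc 0 f), comp_zero]
  · refine biprod.hom_ext' _ _ ?_ ?_
    · rw [comp_zero]; exact h _
    · rw [comp_zero]; exact h' _

theorem homZero_map_biprod [HasFiniteBiproducts C] {S : C ⥤ C} [S.Additive] {X Y Y' : C} :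
    HomZero X (S.obj (Y ⊞ Y')) ↔ HomZero X (S.obj Y) ∧ HomZero X (S.obj Y') := by
  refine ⟨fun h => ⟨fun f => ?_, fun f => ?_⟩, fun ⟨h, h'⟩ f => ?_⟩
  · have : S.map (biprod.inl : Y ⟶ Y ⊞ Y') ≫ S.map biprod.fst = 𝟙 _ := by
      rw [← S.map_comp, biprod.inl_fst, S.map_id]
    rw [← Category.comp_id f, ← this, ← Category.assoc, h (f ≫ _), zero_comp]
  · have : S.map (biprod.inr : Y' ⟶ Y ⊞ Y') ≫ S.map biprod.snd = 𝟙 _ := by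
      rw [← S.map_comp, biprod.inr_snd, S.map_id]
    rw [← Category.comp_id f, ← this, ← Category.assoc, h (f ≫ _), zero_comp]
  · rw [← Category.comp_id f, ← S.map_id, ← biprod.total, S.map_add, Preadditive.comp_add,
      S.map_comp, S.map_comp, ← Category.assoc, ← Category.assoc, h (f ≫ S.map biprod.fst),
      h' (f ≫ S.map biprod.snd), zero_comp, zero_comp, add_zero]

theorem homZero_map_map {S : C ⥤ C} [S.IsEquivalence] [S.Additive] {X Y : C} :
    HomZero (S.obj X) (S.obj Y) ↔ HomZero X Y :=
  ⟨fun h f => S.map_injective (by rw [h (S.map f), S.map_zero]),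
    fun h f => by rw [← S.map_preimage f, h (S.preimage f), S.map_zero]⟩

theorem IsCalabiYau.homZero_symm {k : Type w} [Field k] [Linear k C] {S : C ⥤ C}
    (hCY : IsCalabiYau k S) {X Y : C} (h : HomZero X (S.obj Y)) : HomZero Y (S.obj X) := by
  obtain ⟨e, -⟩ := hCY
  intro f
  refine (Module.forall_dual_apply_eq_zero_iff k f).1 fun φ => ?_
  rw [← (e X Y).apply_symm_apply φ, h ((e X Y).symm φ), map_zero, LinearMap.zero_apply]

theorem IsCalabiYau.homZero_comm {k : Type w} [Field k] [Linear k C] {S : C ⥤ C}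
    (hCY : IsCalabiYau k S) {X Y : C} : HomZero X (S.obj Y) ↔ HomZero Y (S.obj X) :=
  ⟨hCY.homZero_symm, hCY.homZero_symm⟩

end CalabiYau

/-! ### Vanishing of `C(X, S Y)` and membership in `add X` in terms of modules -/

section Comparison

variable (k : Type w) [Field k] {C : Type u} [Category.{v} C] [Preadditive C] [Linear k C]
  [HasFiniteBiproducts C] [∀ X Y : C, Module.Finite k (X ⟶ Y)] [IsIdempotentComplete C]
  {S : C ⥤ C} [S.IsEquivalence] [S.Additive] {T : C} {m : ℕ} {𝒜 : Angulation S (m + 1)}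

/-- The kernel of the last step of the resolution of `C(T, N)` is superfluous. -/
theorem superfluous_ker_homMap {N : C}
    (hN : HasNoSummandInAdd N (S.obj T)) {A : AngleSeq S (m + 1)} (hA : 𝒜.IsAngle A)
    (hA₀ : add T A.fst) (e : A.fin ≅ N) (V : Submodule (End T)ᵐᵒᵖ (homObj k T A.fst))
    (hV : V ⊔ LinearMap.ker (homMap k T A.fstMap).rangeRestrict = ⊤) : V = ⊤ := by
  set π := (homMap k T A.fstMap).rangeRestrict with hπ
  have := projective_homObj k hA₀
  have hsurj : Function.Surjective (π ∘ₗ V.subtype) := by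
    intro y
    obtain ⟨x, rfl⟩ := LinearMap.surjective_rangeRestrict _ y
    obtain ⟨a, ha, b, hb, hab⟩ := Submodule.mem_sup.1 (hV ▸ Submodule.mem_top : x ∈ V ⊔ _)
    refine ⟨⟨a, ha⟩, ?_⟩
    change π a = π x
    rw [← hab, map_add, LinearMap.mem_ker.1 hb, add_zero]
  -- Lifting `π` through `V` gives an endomorphism `ε` of `A.fst` with image in `V` and `ε ≫
  -- A.fstMap = A.fstMap`. Then `S (1 - ε)` factors through `N`, hence is radical, so `ε` is
  -- invertible and `V` is everything.
  obtain ⟨g, hg⟩ := Module.projective_lifting_property (π ∘ₗ V.subtype) π hsurj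
  obtain ⟨ε, hε⟩ := exists_homMap_eq_of_add k hA₀ (V.subtype ∘ₗ g)
  have hε' : ε ≫ A.fstMap = A.fstMap := eq_of_forall_comp hA₀ ((homMap_eq_iff k _ _).1 (by
    rw [homMap_comp, hε]
    exact LinearMap.ext fun x => congrArg Subtype.val (LinearMap.congr_fun hg x)))
  obtain ⟨(y : S.obj A.fst ⟶ A.fin),
    (hy : y ≫ A.finMap = S.map (𝟙 A.fst - ε))⟩ :=
    (Angulation.weakExact_last_map hA).lift (S.map (𝟙 A.fst - ε)) (by
    change S.map _ ≫ S.map A.fstMap = 0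
    rw [← S.map_comp, Preadditive.sub_comp, hε', Category.id_comp, sub_self, S.map_zero])
  have hS : IsIso (S.map ε) := by
    have := hN.radicalThrough k (add_map hA₀) (y ≫ e.hom) (e.inv ≫ A.finMap)
    have heq : (y ≫ e.hom) ≫ e.inv ≫ A.finMap = S.map (𝟙 A.fst - ε) := by
      rw [← hy]; simp
    rwa [heq, S.map_sub, S.map_id, sub_sub_cancel] at this
  have hiso : IsIso ε := isIso_of_reflects_iso ε S
  rw [eq_top_iff]
  intro x _
  have hx : x = homMap k T ε ((toHom k).symm (toHom k x ≫ inv ε)) :=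
    (toHom k).injective (by simp)
  rw [hx, hε]
  exact (g _).2

/-- Both sides say that every `T_0 ⟶ M` extends along `T_0 ⟶ T_1`, where `T_0 ⟶ T_1 ⟶ ⋯ ⟶ N ⟶ S T_0`
is the angle of `N`: by weak exactness, `h : T_0 ⟶ M` extends exactly when `N ⟶ S T_0 ⟶ S M` is
zero, and every map from `N` to `S U` factors through `S T_0`. -/
theorem homTauZero_homObj_iff (hT : IsClusterTilting 𝒜 T) {M N : C}
    (hN : HasNoSummandInAdd N (S.obj T)) :
    HomTauZero k (m + 1) (homObj k T M) (homObj k T N) ↔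
      ∀ (U : C) (p : N ⟶ S.obj U) (q : S.obj U ⟶ S.obj M), add T U → p ≫ q = 0 := by
  obtain ⟨A, hA, hadd, ⟨(e : A.fin ≅ N)⟩⟩ := hT.2 N
  have hA₀ : add T A.fst := hadd 0
  have hA₁ : add T A.snd := hadd (Fin.succ 0)
  have hart := artinian_end k T
  have hwl : WeakExact A.finMap (S.map A.fstMap) := Angulation.weakExact_last_map hA
  -- `C(T, N)` is the last image in the resolution
  let E : LinearMap.range (homMap k T (A.map (Fin.last (m + 1)))) ≃ₗ[(End T)ᵐᵒᵖ] homObj k T N :=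
    (LinearEquiv.ofTop _ (LinearMap.range_eq_top.2 fun x => by
      obtain ⟨y, hy⟩ := (Angulation.weakExact_last hA).lift (toHom k x)
        (homZero_of_add_of_add hT.1 (add_self T) hA₀ _)
      exact ⟨(toHom k).symm y, (toHom k).injective (by simpa using hy)⟩)).trans (homEquivOfIso k e)
  have hext : ∀ (X : Type v) [AddCommGroup X] [Module (End T)ᵐᵒᵖ X],
      ExtZero (End T)ᵐᵒᵖ (m + 1) (homObj k T N) X ↔ _ := fun X _ _ =>
    (extZero_congr E X (m + 1)).symm.trans
      (extZero_range_last_iff k hA (fun i => hadd i.succ) X (Fin.last m))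
  rw [homTauZero_iff k (Nat.le_add_left 1 m)]
  constructor
  · intro H U p q hU
    -- The factorization through `S T_0` exists because `C(T_n, S U) = 0`.
    obtain ⟨(p' : S.obj A.fst ⟶ S.obj U), (hp' : A.finMap ≫ p' = e.hom ≫ p)⟩ := (Angulation.weakExact_last hA).desc (e.hom ≫ p)
      (homZero_of_add_of_add hT.1 (hadd (Fin.last (m + 1))) hU _)
    obtain ⟨h, hh⟩ := S.map_surjective (p' ≫ q)
    have := projective_homObj k hA₁
    obtain ⟨g, hg⟩ := exists_extension_of_quotient (homMap k T A.fstMap).rangeRestrict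
      (LinearMap.surjective_rangeRestrict _) (superfluous_ker_homMap k hN hA hA₀ e)
      (Submodule.subtype _) (fun W => (hext _).1 (H _ W.mkQ W.mkQ_surjective)) (homMap k T h)
    obtain ⟨y, rfl⟩ := exists_homMap_eq_of_add k hA₁ g
    have hy : A.fstMap ≫ y = h := eq_of_forall_comp hA₀ ((homMap_eq_iff k _ _).1 (by
      rw [homMap_comp, ← hg]; rfl))
    rw [← cancel_epi e.hom, comp_zero, ← Category.assoc, ← hp', Category.assoc, ← hh, ← hy,
      S.map_comp, ← Category.assoc, hwl.zero, zero_comp]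
  · intro H X _ _ r hr
    rw [hext]
    have := projective_homObj k hA₀
    refine exists_extension_quotient (homMap k T A.fstMap).rangeRestrict
      (LinearMap.surjective_rangeRestrict _) _ (fun g => ?_) r hr
    obtain ⟨h, rfl⟩ := exists_homMap_eq_of_add k hA₀ g
    have h0 : A.finMap ≫ S.map h = 0 := by
      rw [← cancel_epi e.inv, comp_zero, ← Category.assoc]
      exact H _ _ _ hA₀
    obtain ⟨y, hy⟩ := hwl.desc _ h0
    refine ⟨homMap k T (S.preimage y), ?_⟩
    have : A.fstMap ≫ S.preimage y = h := S.map_injective (by simpa using hy)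
    rw [← this, homMap_comp]
    rfl

theorem homZero_iff_homTauZero (hCY : IsCalabiYau k S) (hT : IsClusterTilting 𝒜 T) {M N : C}
    (hM : HasNoSummandInAdd M (S.obj T)) (hN : HasNoSummandInAdd N (S.obj T)) :
    HomZero M (S.obj N) ↔ HomTauZero k (m + 1) (homObj k T M) (homObj k T N) ∧
      HomTauZero k (m + 1) (homObj k T N) (homObj k T M) := by
  rw [homTauZero_homObj_iff k hT hN, homTauZero_homObj_iff k hT hM]
  constructor
  · exact fun h => ⟨fun U p q _ => hCY.homZero_symm h _, fun U p q _ => h _⟩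
  · rintro ⟨h1, h2⟩ f
    obtain ⟨U₁, U₀, U, b, a, c, hU₁, hU₀, hU, hba, hac⟩ := hT.exists_presentation N
    -- Under duality `f ≫ S c` becomes the functional `q ↦ e f (c ≫ q)` on `C(S U, S M)`. The
    -- composites `c ≫ q : N ⟶ S U ⟶ S M` vanish by `h1`, so `f` lifts to a map through `S U₀`,
    -- where `h2` applies.
    have hfc : f ≫ S.map c = 0 := by
      obtain ⟨e, he⟩ := hCY
      refine (e M (S.obj U)).injective (LinearMap.ext fun q => ?_)
      have := he M M N (S.obj U) (𝟙 M) c f q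
      rw [Category.id_comp, S.map_id, Category.comp_id, h1 U c q hU, map_zero] at this
      rw [this, map_zero, LinearMap.zero_apply]
    obtain ⟨g, hg⟩ := hac.map.lift f hfc
    rw [← hg]
    exact h2 U₀ g (S.map a) hU₀

/-- Vanishing of `C(X, S Y)` for `X = M ⊞ S U` and `Y = N ⊞ S V`. -/
theorem homZero_biprod_iff (hCY : IsCalabiYau k S) (hT : IsClusterTilting 𝒜 T) {M N U V : C}
    (hM : HasNoSummandInAdd M (S.obj T)) (hN : HasNoSummandInAdd N (S.obj T))
    (hU : add T U) (hV : add T V) :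
    HomZero (M ⊞ S.obj U) (S.obj (N ⊞ S.obj V)) ↔
      (HomTauZero k (m + 1) (homObj k T M) (homObj k T N) ∧
        HomTauZero k (m + 1) (homObj k T N) (homObj k T M) ∧
        ModHomZero (homObj k T U) (homObj k T N)) ∧
      ModHomZero (homObj k T V) (homObj k T M) := by
  rw [homZero_map_biprod, homZero_biprod_left, homZero_biprod_left, homZero_map_map,
    homZero_map_map, hCY.homZero_comm (X := M) (Y := S.obj V), homZero_map_map,
    modHomZero_iff k hU, modHomZero_iff k hV, homZero_iff_homTauZero k hCY hT hM hN]
  -- Of the four blocks, the one from `S U` to `S (S V)` vanishes automatically, since `C(U, S V) =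
  -- 0`; the one from `M` to `S (S V)` has been dualized to `C(V, M)`.
  have := homZero_of_add_of_add hT.1 hU hV
  tauto

/-- `add (M ⊞ S U)`. -/
theorem add_biprod_iff (hT : IsClusterTilting 𝒜 T) {M N U V : C}
    (hM : HasNoSummandInAdd M (S.obj T)) (hN : HasNoSummandInAdd N (S.obj T))
    (hU : add T U) (hV : add T V) :
    add (M ⊞ S.obj U) (N ⊞ S.obj V) ↔
      addMod (homObj k T M) (homObj k T N) ∧ addMod (homObj k T U) (homObj k T V) := by
  rw [← hN.add_iff k hT]
  constructor
  · intro h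
    have h1 : add (M ⊞ S.obj U) N :=
      (add_of_retract biprod.inl biprod.fst biprod.inl_fst).trans h
    have h2 : add (M ⊞ S.obj U) (S.obj V) :=
      (add_of_retract biprod.inr biprod.snd biprod.inr_snd).trans h
    refine ⟨?_, addMod_of_add k (add_map_iff.1
      ((hM.radicalThrough k (add_map hV)).add_of_add_biprod h2))⟩
    exact (hN.radicalThrough_add k (add_map hU)).add_of_add_biprod
      (h1.trans (add_of_iso (biprod.braiding _ _)))
  · rintro ⟨h1, h2⟩
    exact add_biprod (h1.trans (add_of_retract biprod.inl biprod.fst biprod.inl_fst))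
      ((add_map (add_of_addMod k hU hV h2)).trans
        (add_of_retract biprod.inr biprod.snd biprod.inr_snd))

end Comparison

end HigherAngulated

namespace HigherAR

/-! ### Invariance of the conditions on pairs under isomorphism -/

section

variable (k : Type w) [Field k] {R : Type v} [Ring R] [Algebra k R] [Module.Finite k R] {n : ℕ}
  {𝒟 : ObjectProperty (FGModuleCat.{v} R)} [𝒟.IsClosedUnderIsomorphisms]

/-- A linear equivalence as an isomorphism of finitely generated modules. -/
def isoOfEquiv {M N : FGModuleCat.{v} R} (e : M ≃ₗ[R] N) : M ≅ N :=
  LinearEquiv.toFGModuleCatIso e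

theorem nonempty_prod_iso_iff {p q : FGModuleCat.{v} R × FGModuleCat.{v} R} :
    Nonempty (p ≅ q) ↔ Nonempty (p.1 ≃ₗ[R] q.1) ∧ Nonempty (p.2 ≃ₗ[R] q.2) := by
  constructor
  · rintro ⟨e⟩
    exact ⟨⟨FGModuleCat.isoToLinearEquiv ((CategoryTheory.Prod.fst _ _).mapIso e)⟩,
      ⟨FGModuleCat.isoToLinearEquiv ((CategoryTheory.Prod.snd _ _).mapIso e)⟩⟩
  · rintro ⟨⟨e⟩, ⟨e'⟩⟩
    exact ⟨Iso.prod (isoOfEquiv e) (isoOfEquiv e')⟩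

variable {p q : FGModuleCat.{v} R × FGModuleCat.{v} R}

theorem IsTauRigidPair.of_equiv (hn : 1 ≤ n) (e : p.1 ≃ₗ[R] q.1) (e' : p.2 ≃ₗ[R] q.2)
    (h : IsTauRigidPair k n 𝒟 p) : IsTauRigidPair k n 𝒟 q := by
  obtain ⟨⟨h1, h2⟩, h3, h4⟩ := h
  exact ⟨⟨𝒟.prop_of_iso (isoOfEquiv e) h1, Module.Projective.of_equiv e'⟩, h3.of_equiv k hn e e,
    h4.of_equiv e' e⟩

theorem IsSupportTauTiltingPair.of_equiv (hn : 1 ≤ n) (e : p.1 ≃ₗ[R] q.1) (e' : p.2 ≃ₗ[R] q.2)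
    (h : IsSupportTauTiltingPair k n 𝒟 p) : IsSupportTauTiltingPair k n 𝒟 q := by
  obtain ⟨h1, h2, h3⟩ := h
  refine ⟨h1.of_equiv k hn e e', fun N hN hr => ?_, fun Q hQ => ?_⟩
  · exact (h2 N hN (hr.of_equiv k hn (p := (FGModuleCat.of R (q.1 × N), q.2))
      (q := (FGModuleCat.of R (p.1 × N), p.2))
      (e.symm.prodCongr (LinearEquiv.refl R N)) e'.symm)).of_equiv e (LinearEquiv.refl R N)
  · have := h3 Q hQ
    exact ⟨fun h => (this.1 (h.of_equiv e'.symm (LinearEquiv.refl R Q))).of_equiv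
      (LinearEquiv.refl R Q) e, fun h => (this.2 (h.of_equiv
      (LinearEquiv.refl R Q) e.symm)).of_equiv e' (LinearEquiv.refl R Q)⟩

theorem IsMaximalTauRigidPair.of_equiv (hn : 1 ≤ n) (e : p.1 ≃ₗ[R] q.1) (e' : p.2 ≃ₗ[R] q.2)
    (h : IsMaximalTauRigidPair k n 𝒟 p) : IsMaximalTauRigidPair k n 𝒟 q := by
  obtain ⟨⟨h1, h1'⟩, h2, h3⟩ := h
  refine ⟨⟨𝒟.prop_of_iso (isoOfEquiv e) h1, Module.Projective.of_equiv e'⟩, fun N hN => ?_,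
    fun Q hQ => ?_⟩
  · have := h2 N hN
    have r := LinearEquiv.refl R N
    constructor
    · intro h
      obtain ⟨a, b, c⟩ := this.1 (h.of_equiv e.symm r)
      exact ⟨a.of_equiv k hn e r, b.of_equiv k hn r e, c.of_equiv e' r⟩
    · rintro ⟨a, b, c⟩
      exact (this.2 ⟨a.of_equiv k hn e.symm r, b.of_equiv k hn r e.symm,
        c.of_equiv e'.symm r⟩).of_equiv e r
  · have := h3 Q hQ
    exact ⟨fun h => (this.1 (h.of_equiv e'.symm (LinearEquiv.refl R Q))).of_equiv
      (LinearEquiv.refl R Q) e, fun h => (this.2 (h.of_equiv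
      (LinearEquiv.refl R Q) e.symm)).of_equiv e' (LinearEquiv.refl R Q)⟩

end

end HigherAR

namespace HigherAngulated

open HigherAR

/-! ### Invariance of the conditions on objects under isomorphism -/

section

variable {C : Type u} [Category.{v} C] [Preadditive C] {S : C ⥤ C}

theorem IsRigid.of_iso {X X' : C} (e : X ≅ X') (h : IsRigid S X) : IsRigid S X' :=
  HomZero.of_iso e (S.mapIso e) h

variable [HasFiniteBiproducts C] [IsIdempotentComplete C]

theorem add_iff_of_iso {X X' Y Y' : C} (e : X ≅ X') (e' : Y ≅ Y') : add X Y ↔ add X' Y' :=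
  ⟨fun h => ((add_of_iso e'.symm).trans h).trans (add_of_iso e),
    fun h => ((add_of_iso e').trans h).trans (add_of_iso e.symm)⟩

omit [HasFiniteBiproducts C] [IsIdempotentComplete C] in
theorem homZero_iff_of_iso {X X' Y Y' : C} (e : X ≅ X') (e' : Y ≅ Y') :
    HomZero X Y ↔ HomZero X' Y' :=
  ⟨HomZero.of_iso e e', HomZero.of_iso e.symm e'.symm⟩

theorem IsMaximalRigid.of_iso {X X' : C} (e : X ≅ X') (h : IsMaximalRigid S X) :
    IsMaximalRigid S X' := by
  refine ⟨h.1.of_iso e, fun M => ?_⟩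
  rw [← add_iff_of_iso e (Iso.refl M), h.2]
  let i := biprod.mapIso e (Iso.refl M)
  exact homZero_iff_of_iso i (S.mapIso i)

theorem IsSelfPerpendicular.of_iso {X X' : C} (e : X ≅ X') (h : IsSelfPerpendicular S X) :
    IsSelfPerpendicular S X' := by
  refine ⟨fun M => ?_, fun M => ?_⟩
  · rw [← add_iff_of_iso e (Iso.refl M), h.1]
    exact homZero_iff_of_iso e (Iso.refl _)
  · rw [← add_iff_of_iso e (Iso.refl M), h.2]
    exact homZero_iff_of_iso (Iso.refl _) (S.mapIso e)

omit [IsIdempotentComplete C] in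
theorem homZero_biprod_biprod_iff [S.Additive] {X Y : C} :
    HomZero (X ⊞ Y) (S.obj (X ⊞ Y)) ↔ (HomZero X (S.obj X) ∧ HomZero Y (S.obj X)) ∧
      HomZero X (S.obj Y) ∧ HomZero Y (S.obj Y) := by
  rw [homZero_map_biprod, homZero_biprod_left, homZero_biprod_left]

end

/-! ### The correspondence between objects and pairs -/

section Correspondence

variable (k : Type w) [Field k] {C : Type u} [Category.{v} C] [Preadditive C] [Linear k C]
  [HasFiniteBiproducts C] [∀ X Y : C, Module.Finite k (X ⟶ Y)] [IsIdempotentComplete C]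
  {S : C ⥤ C} [S.IsEquivalence] [S.Additive] {T : C} {m : ℕ} {𝒜 : Angulation S (m + 1)}

omit [S.IsEquivalence] in
/-- `C(T, M) ≅ C(T, M ⊞ S U)` for `U` in `add T`. -/
theorem nonempty_homObj_equiv_biprod (hT : IsClusterTilting 𝒜 T) (M : C) {U : C} (hU : add T U) :
    Nonempty (homObj k T M ≃ₗ[(End T)ᵐᵒᵖ] homObj k T (M ⊞ S.obj U)) := by
  refine ⟨LinearEquiv.ofLinearMap (homMap k T biprod.inl) (homMap k T biprod.fst) ?_ ?_⟩
  · rw [← homMap_comp]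
    refine LinearMap.ext fun x => (toHom k).injective ?_
    change toHom k x ≫ biprod.fst ≫ biprod.inl = toHom k x
    have h0 : toHom k x ≫ biprod.snd = 0 := homZero_of_add_of_add hT.1 (add_self T) hU _
    rw [eq_sub_of_add_eq (biprod.total (X := M) (Y := S.obj U)), Preadditive.comp_sub,
      Category.comp_id, ← Category.assoc, h0, zero_comp, sub_zero]
  · rw [← homMap_comp, biprod.inl_fst]
    exact LinearMap.ext fun x => (toHom k).injective (Category.comp_id _)

variable (S) in
include k in
theorem exists_decomposition_map (T X : C) :
    ∃ M U : C, HasNoSummandInAdd M (S.obj T) ∧ add T U ∧ Nonempty (M ⊞ S.obj U ≅ X) := by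
  obtain ⟨M, V, hM, hV, ⟨e⟩⟩ := exists_decomposition k (S.obj T) X
  obtain ⟨U, hU, ⟨e'⟩⟩ := exists_iso_map_of_add hV
  exact ⟨M, U, hM, hU, ⟨biprod.mapIso (Iso.refl M) e'.symm ≪≫ e⟩⟩

theorem exists_equiv_of_essImage (hT : IsClusterTilting 𝒜 T) (N : FGModuleCat.{v} (End T)ᵐᵒᵖ)
    (hN : (homFunctor k T).essImage N) :
    ∃ M, HasNoSummandInAdd M (S.obj T) ∧ Nonempty (homObj k T M ≃ₗ[(End T)ᵐᵒᵖ] N) := by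
  obtain ⟨X, ⟨i⟩⟩ := hN
  obtain ⟨M, U, hM, hU, ⟨e⟩⟩ := exists_decomposition_map k S T X
  obtain ⟨f⟩ := nonempty_homObj_equiv_biprod k hT M hU
  exact ⟨M, hM, ⟨f.trans ((homEquivOfIso k e).trans (FGModuleCat.isoToLinearEquiv i))⟩⟩

/-- The pair attached to `M ⊞ S U` determines it up to isomorphism, and conversely. -/
theorem nonempty_biprod_iso_iff (hT : IsClusterTilting 𝒜 T) {M M' U U' : C}
    (hM : HasNoSummandInAdd M (S.obj T)) (hM' : HasNoSummandInAdd M' (S.obj T))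
    (hU : add T U) (hU' : add T U') :
    Nonempty (M ⊞ S.obj U ≅ M' ⊞ S.obj U') ↔
      Nonempty ((homObj k T M, homObj k T U) ≅ (homObj k T M', homObj k T U')) := by
  rw [nonempty_prod_iso_iff]
  constructor
  · rintro ⟨e⟩
    obtain ⟨i⟩ := nonempty_iso_of_biprod_iso k hM hM' (add_map hU) (add_map hU') e
    obtain ⟨f⟩ := nonempty_homObj_equiv_biprod k hT M hU
    obtain ⟨f'⟩ := nonempty_homObj_equiv_biprod k hT M' hU'
    exact ⟨⟨f.trans ((homEquivOfIso k e).trans f'.symm)⟩, ⟨homEquivOfIso k (S.preimageIso i)⟩⟩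
  · rintro ⟨⟨e⟩, ⟨e'⟩⟩
    obtain ⟨i⟩ := hM.nonempty_iso k hT hM' e
    obtain ⟨f, hf⟩ := exists_homMap_eq_of_add k hU e'.toLinearMap
    obtain ⟨g, hg⟩ := exists_homMap_eq_of_add k hU' e'.symm.toLinearMap
    have hfg : f ≫ g = 𝟙 U := eq_of_forall_comp hU ((homMap_eq_iff k _ _).1 (by
      rw [homMap_comp, hf, hg]
      exact LinearMap.ext fun x => (e'.symm_apply_apply x).trans
        ((toHom k).injective (Category.comp_id _).symm)))
    have hgf : g ≫ f = 𝟙 U' := eq_of_forall_comp hU' ((homMap_eq_iff k _ _).1 (by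
      rw [homMap_comp, hf, hg]
      exact LinearMap.ext fun x => (e'.apply_symm_apply x).trans
        ((toHom k).injective (Category.comp_id _).symm)))
    exact ⟨biprod.mapIso i (S.mapIso ⟨f, g, hfg, hgf⟩)⟩

variable {M U : C}

theorem isRigid_iff (hCY : IsCalabiYau k S) (hT : IsClusterTilting 𝒜 T)
    (hM : HasNoSummandInAdd M (S.obj T)) (hU : add T U) :
    IsRigid S (M ⊞ S.obj U) ↔ IsTauRigidPair k (m + 1) (homFunctor k T).essImage
      (homObj k T M, homObj k T U) := by
  have h1 : (homFunctor k T).essImage (homObj k T M) := (homFunctor k T).obj_mem_essImage M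
  have h2 := projective_homObj k hU
  rw [IsRigid, homZero_biprod_iff k hCY hT hM hM hU hU, IsTauRigidPair]
  dsimp only
  tauto

theorem isTauRigidPair_prod_iff (hCY : IsCalabiYau k S) (hT : IsClusterTilting 𝒜 T)
    (hM : HasNoSummandInAdd M (S.obj T)) (hU : add T U) {N : C}
    (hN : HasNoSummandInAdd N (S.obj T)) :
    IsTauRigidPair k (m + 1) (homFunctor k T).essImage
        (FGModuleCat.of _ (homObj k T M × homObj k T N), homObj k T U) ↔
      HomZero ((M ⊞ S.obj U) ⊞ N) (S.obj ((M ⊞ S.obj U) ⊞ N)) := by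
  let i : (M ⊞ N) ⊞ S.obj U ≅ (M ⊞ S.obj U) ⊞ N := biprod.associator M N (S.obj U) ≪≫
    biprod.mapIso (Iso.refl M) (biprod.braiding _ _) ≪≫ (biprod.associator M (S.obj U) N).symm
  rw [← homZero_iff_of_iso i (S.mapIso i)]
  refine Iff.trans ?_ (isRigid_iff k hCY hT (hM.biprod k hN) hU).symm
  have e := homBiprodEquiv k (T := T) M N
  exact ⟨IsTauRigidPair.of_equiv k (Nat.le_add_left 1 m) e.symm (LinearEquiv.refl _ _),
    IsTauRigidPair.of_equiv k (Nat.le_add_left 1 m) e (LinearEquiv.refl _ _)⟩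

theorem isMaximalRigid_iff (hCY : IsCalabiYau k S) (hT : IsClusterTilting 𝒜 T)
    (hM : HasNoSummandInAdd M (S.obj T)) (hU : add T U) :
    IsMaximalRigid S (M ⊞ S.obj U) ↔ IsSupportTauTiltingPair k (m + 1) (homFunctor k T).essImage
      (homObj k T M, homObj k T U) := by
  rw [IsMaximalRigid, IsSupportTauTiltingPair, ← isRigid_iff k hCY hT hM hU]
  refine and_congr_right fun hX => ?_
  have hadd := fun {N V} => add_biprod_iff k hT (M := M) (N := N) (U := U) (V := V) hM
  have hzero := fun {N V} => homZero_biprod_iff k hCY hT (M := M) (N := N) (U := U) (V := V) hM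
  have hXX := (hzero hM hU hU).1 hX
  have hMM : addMod (homObj k T M) (homObj k T M) := addMod_of_add k (add_self M)
  have hUU : addMod (homObj k T U) (homObj k T U) := addMod_of_add k (add_self U)
  constructor
  · intro H
    refine ⟨fun N hN hr => ?_, fun Q hQ => ?_⟩
    · obtain ⟨N₀, hN₀, ⟨e⟩⟩ := exists_equiv_of_essImage k hT N hN
      have hr' := (isTauRigidPair_prod_iff k hCY hT hM hU hN₀).1
        (hr.of_equiv k (Nat.le_add_left 1 m)
          (p := (FGModuleCat.of _ (homObj k T M × N), homObj k T U))
          (q := (FGModuleCat.of _ (homObj k T M × homObj k T N₀), homObj k T U))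
          ((LinearEquiv.refl _ _).prodCongr e.symm) (LinearEquiv.refl _ _))
      obtain ⟨f⟩ := nonempty_homObj_equiv_biprod k hT M hU
      exact (addMod_of_add k ((H N₀).2 hr')).of_equiv f.symm e
    · obtain ⟨V, hV, ⟨e⟩⟩ := exists_equiv_homObj_of_projective k Q
      have key : addMod (homObj k T U) (homObj k T V) ↔ ModHomZero (homObj k T V) (homObj k T M) := by
        -- The test object repeats `M`, whose conditions already hold by rigidity, so maximality
        -- becomes a statement about `V` alone.
        have := H (M ⊞ S.obj V)
        rw [hadd hM hU hV, homZero_biprod_biprod_iff, hCY.homZero_comm (X := M ⊞ S.obj V)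
          (Y := M ⊞ S.obj U), hzero hM hU hV, homZero_biprod_iff k hCY hT hM hM hV hV] at this
        have hX' : HomZero (M ⊞ S.obj U) (S.obj (M ⊞ S.obj U)) := hX
        tauto
      exact ⟨fun h => (key.1 (h.of_equiv (LinearEquiv.refl _ _) e.symm)).of_equiv e
        (LinearEquiv.refl _ _), fun h => (key.2 (h.of_equiv e.symm
        (LinearEquiv.refl _ _))).of_equiv (LinearEquiv.refl _ _) e⟩
  · rintro ⟨h1, h2⟩ Y
    constructor
    · intro hY
      have hXY : HomZero (M ⊞ S.obj U) (S.obj Y) := HomZero.of_add_right (add_map hY) hX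
      exact homZero_biprod_biprod_iff.2 ⟨⟨hX, HomZero.of_add hY hX⟩, hXY, HomZero.of_add hY hXY⟩
    · intro hY
      obtain ⟨N, V, hN, hV, ⟨e⟩⟩ := exists_decomposition_map k S T Y
      obtain ⟨-, hXY, hYY⟩ := homZero_biprod_biprod_iff.1 hY
      rw [← homZero_iff_of_iso (Iso.refl _) (S.mapIso e), hzero hN hU hV] at hXY
      rw [← homZero_iff_of_iso e (S.mapIso e), homZero_biprod_iff k hCY hT hN hN hV hV] at hYY
      rw [← add_iff_of_iso (Iso.refl _) e, hadd hN hU hV]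
      refine ⟨h1 _ ((homFunctor k T).obj_mem_essImage N) ?_,
        (h2 _ (projective_homObj k hV)).2 hXY.2⟩
      -- The support condition of the pair compares only modules with the fixed projective, so `S V`
      -- is dropped from `Y` and rigidity is checked with `N` alone.
      refine (isTauRigidPair_prod_iff k hCY hT hM hU hN).2 (homZero_biprod_biprod_iff.2 ?_)
      have hMN := (homZero_iff_homTauZero k hCY hT hM hN).2 ⟨hXY.1.1, hXY.1.2.1⟩
      have hXN : HomZero (M ⊞ S.obj U) (S.obj N) := homZero_biprod_left.2
        ⟨hMN, homZero_map_map.2 ((modHomZero_iff k hU).1 hXY.1.2.2)⟩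
      exact ⟨⟨hX, hCY.homZero_symm hXN⟩, hXN,
        (homZero_iff_homTauZero k hCY hT hN hN).2 ⟨hYY.1.1, hYY.1.1⟩⟩

theorem isSelfPerpendicular_iff (hCY : IsCalabiYau k S) (hT : IsClusterTilting 𝒜 T)
    (hM : HasNoSummandInAdd M (S.obj T)) (hU : add T U) :
    IsSelfPerpendicular S (M ⊞ S.obj U) ↔
      IsMaximalTauRigidPair k (m + 1) (homFunctor k T).essImage
        (homObj k T M, homObj k T U) := by
  have hadd := fun {N V} => add_biprod_iff k hT (M := M) (N := N) (U := U) (V := V) hM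
  have hzero := fun {N V} => homZero_biprod_iff k hCY hT (M := M) (N := N) (U := U) (V := V) hM
  have hMM : addMod (homObj k T M) (homObj k T M) := addMod_of_add k (add_self M)
  have hUU : addMod (homObj k T U) (homObj k T U) := addMod_of_add k (add_self U)
  constructor
  · rintro ⟨H, -⟩
    have key := fun {N V : C} (hN : HasNoSummandInAdd N (S.obj T)) (hV : add T V) =>
      ((hadd hN hU hV).symm.trans (H (N ⊞ S.obj V))).trans (hzero hN hU hV)
    -- Testing the object against itself gives its rigidity. This fills in the half of `key` that is
    -- not being varied: below, first `N` varies with `U` fixed, then `V` varies with `M` fixed.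
    obtain ⟨h0, h0'⟩ := (key hM hU).1 ⟨hMM, hUU⟩
    refine ⟨⟨(homFunctor k T).obj_mem_essImage M, projective_homObj k hU⟩, fun N hN => ?_,
      fun Q hQ => ?_⟩
    · obtain ⟨N₀, hN₀, ⟨e⟩⟩ := exists_equiv_of_essImage k hT N hN
      have h1 := key hN₀ hU
      have r := LinearEquiv.refl (End T)ᵐᵒᵖ (homObj k T M)
      have hm := Nat.le_add_left 1 m
      constructor
      · intro h
        obtain ⟨⟨a, b, c⟩, -⟩ := h1.1 ⟨h.of_equiv r e.symm, hUU⟩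
        exact ⟨a.of_equiv k hm r e, b.of_equiv k hm e r, c.of_equiv (LinearEquiv.refl _ _) e⟩
      · rintro ⟨a, b, c⟩
        exact (h1.2 ⟨⟨a.of_equiv k hm r e.symm, b.of_equiv k hm e.symm r,
          c.of_equiv (LinearEquiv.refl _ _) e.symm⟩, h0'⟩).1.of_equiv r e
    · obtain ⟨V, hV, ⟨e⟩⟩ := exists_equiv_homObj_of_projective k Q
      have h1 := key hM hV
      exact ⟨fun h => (h1.1 ⟨hMM, h.of_equiv (LinearEquiv.refl _ _) e.symm⟩).2.of_equiv e
        (LinearEquiv.refl _ _), fun h => (h1.2 ⟨h0, h.of_equiv e.symm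
        (LinearEquiv.refl _ _)⟩).2.of_equiv (LinearEquiv.refl _ _) e⟩
  · rintro ⟨-, h1, h2⟩
    have key : ∀ Y, add (M ⊞ S.obj U) Y ↔ HomZero (M ⊞ S.obj U) (S.obj Y) := by
      intro Y
      obtain ⟨N, V, hN, hV, ⟨e⟩⟩ := exists_decomposition_map k S T Y
      rw [← homZero_iff_of_iso (Iso.refl _) (S.mapIso e), hzero hN hU hV,
        ← add_iff_of_iso (Iso.refl _) e, hadd hN hU hV]
      exact and_congr (h1 _ ((homFunctor k T).obj_mem_essImage N)) (h2 _ (projective_homObj k hV))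
    -- The two perpendicular conditions coincide by Calabi–Yau symmetry.
    exact ⟨key, fun Y => (key Y).trans hCY.homZero_comm⟩

/-- The common frame of the three bijections: decompositions give injectivity through
`nonempty_biprod_iso_iff`, and any pair with entries in the image of `C(T, -)` and among the
projectives is attained. Only the matching of `P` with `Q` on decomposed objects depends on the
case. -/
theorem bijOn_isoClasses (hT : IsClusterTilting 𝒜 T)
    {F : Quotient (isIsomorphicSetoid C) → Quotient (isIsomorphicSetoid
      (FGModuleCat.{v} (End T)ᵐᵒᵖ × FGModuleCat.{v} (End T)ᵐᵒᵖ))}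
    (hF : ∀ M U : C, HasNoSummandInAdd M (S.obj T) → add T U →
      F (isoClass (M ⊞ S.obj U)) = isoClass (homObj k T M, homObj k T U))
    {P : ObjectProperty C} (hP : ∀ {X X' : C}, (X ≅ X') → P X → P X')
    {Q : ObjectProperty (FGModuleCat.{v} (End T)ᵐᵒᵖ × FGModuleCat.{v} (End T)ᵐᵒᵖ)}
    (hQ : ∀ {p q}, (p.1 ≃ₗ[(End T)ᵐᵒᵖ] q.1) → (p.2 ≃ₗ[(End T)ᵐᵒᵖ] q.2) → Q p → Q q)
    (hQ' : ∀ {p}, Q p → (homFunctor k T).essImage p.1 ∧ Module.Projective (End T)ᵐᵒᵖ p.2)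
    (hPQ : ∀ {M U : C}, HasNoSummandInAdd M (S.obj T) → add T U →
      (P (M ⊞ S.obj U) ↔ Q (homObj k T M, homObj k T U))) :
    Set.BijOn F (isoClasses P) (isoClasses Q) := by
  have hdec : ∀ X : C, ∃ M U : C, HasNoSummandInAdd M (S.obj T) ∧ add T U ∧
      isoClass (M ⊞ S.obj U) = isoClass X ∧ Nonempty (M ⊞ S.obj U ≅ X) := fun X => by
    obtain ⟨M, U, hM, hU, e⟩ := exists_decomposition_map k S T X
    exact ⟨M, U, hM, hU, Quotient.sound e, e⟩
  refine ⟨?_, ?_, ?_⟩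
  · rintro _ ⟨X, hX, rfl⟩
    obtain ⟨M, U, hM, hU, h, ⟨e⟩⟩ := hdec X
    exact ⟨_, (hPQ hM hU).1 (hP e.symm hX), by rw [← h, hF M U hM hU]⟩
  · rintro _ ⟨X, -, rfl⟩ _ ⟨X', -, rfl⟩ hXX'
    obtain ⟨M, U, hM, hU, h, -⟩ := hdec X
    obtain ⟨M', U', hM', hU', h', -⟩ := hdec X'
    rw [← h, ← h', hF M U hM hU, hF M' U' hM' hU'] at hXX'
    rw [← h, ← h']
    exact Quotient.sound ((nonempty_biprod_iso_iff k hT hM hM' hU hU').2 (Quotient.exact hXX'))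
  · rintro _ ⟨p, hp, rfl⟩
    obtain ⟨M, hM, ⟨e⟩⟩ := exists_equiv_of_essImage k hT p.1 (hQ' hp).1
    have := (hQ' hp).2
    obtain ⟨U, hU, ⟨e'⟩⟩ := exists_equiv_homObj_of_projective k p.2
    refine ⟨isoClass (M ⊞ S.obj U), ⟨_, (hPQ hM hU).2 (hQ e.symm e'.symm hp), rfl⟩, ?_⟩
    rw [hF M U hM hU]
    exact Quotient.sound (nonempty_prod_iso_iff.2 ⟨⟨e⟩, ⟨e'⟩⟩)

theorem exists_map_isoClass (hT : IsClusterTilting 𝒜 T) :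
    ∃ F : Quotient (isIsomorphicSetoid C) → Quotient (isIsomorphicSetoid
        (FGModuleCat.{v} (End T)ᵐᵒᵖ × FGModuleCat.{v} (End T)ᵐᵒᵖ)),
      ∀ M U : C, HasNoSummandInAdd M (S.obj T) → add T U →
        F (isoClass (M ⊞ S.obj U)) = isoClass (homObj k T M, homObj k T U) := by
  choose M U hM hU e using exists_decomposition_map k S T
  have key : ∀ X X' : C, Nonempty (X ≅ X') →
      isoClass (homObj k T (M X), homObj k T (U X)) =
        isoClass (homObj k T (M X'), homObj k T (U X')) := fun X X' ⟨i⟩ => by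
    obtain ⟨f⟩ := e X
    obtain ⟨f'⟩ := e X'
    exact Quotient.sound ((nonempty_biprod_iso_iff k hT (hM X) (hM X') (hU X) (hU X')).1
      ⟨f ≪≫ i ≪≫ f'.symm⟩)
  refine ⟨Quotient.lift (fun X => isoClass (homObj k T (M X), homObj k T (U X))) key,
    fun M' U' hM' hU' => ?_⟩
  exact Quotient.sound ((nonempty_biprod_iso_iff k hT (hM _) hM' (hU _) hU').1 (e _))

end Correspondence

end HigherAngulated

end

theorem corollary3p8 {k : Type w} [Field k] {C : Type u} [Category.{v} C] [Preadditive C]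
    [Linear k C] [HasFiniteBiproducts C] [IsIdempotentComplete C]
    [∀ X Y : C, Module.Finite k (X ⟶ Y)]
    {n : ℕ} (hn : 1 ≤ n)
    (S : C ⥤ C) [S.IsEquivalence] [S.Additive] [S.Linear k]
    (𝒜 : HigherAngulated.Angulation S n)
    (hCY : HigherAngulated.IsCalabiYau k S)
    (T : C) (hT : HigherAngulated.IsClusterTilting 𝒜 T) :
    ∃ F : Quotient (isIsomorphicSetoid C) →
        Quotient (isIsomorphicSetoid
          (FGModuleCat.{v} (End T)ᵐᵒᵖ × FGModuleCat.{v} (End T)ᵐᵒᵖ)),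
      (∀ M₀ T' : C, HigherAngulated.HasNoSummandInAdd M₀ (S.obj T) →
        HigherAngulated.add T T' →
        F (HigherAngulated.isoClass (M₀ ⊞ S.obj T')) =
          HigherAngulated.isoClass ((HigherAngulated.homFunctor k T).obj M₀,
            (HigherAngulated.homFunctor k T).obj T')) ∧
      Set.BijOn F
        (HigherAngulated.isoClasses (HigherAngulated.IsRigid S))
        (HigherAngulated.isoClasses
          (HigherAR.IsTauRigidPair k n (HigherAngulated.homFunctor k T).essImage)) ∧
      Set.BijOn F
        (HigherAngulated.isoClasses (HigherAngulated.IsMaximalRigid S))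
        (HigherAngulated.isoClasses
          (HigherAR.IsSupportTauTiltingPair k n (HigherAngulated.homFunctor k T).essImage)) ∧
      Set.BijOn F
        (HigherAngulated.isoClasses (HigherAngulated.IsSelfPerpendicular S))
        (HigherAngulated.isoClasses
          (HigherAR.IsMaximalTauRigidPair k n (HigherAngulated.homFunctor k T).essImage)) := by
  obtain ⟨m, rfl⟩ : ∃ m, n = m + 1 := ⟨n - 1, by omega⟩
  obtain ⟨F, hF⟩ := HigherAngulated.exists_map_isoClass k hT
  refine ⟨F, hF, ?_, ?_, ?_⟩
  · exact HigherAngulated.bijOn_isoClasses k hT hF (fun e h => h.of_iso e)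
      (fun e e' h => h.of_equiv k hn e e') (fun h => h.1)
      (HigherAngulated.isRigid_iff k hCY hT)
  · exact HigherAngulated.bijOn_isoClasses k hT hF (fun e h => h.of_iso e)
      (fun e e' h => h.of_equiv k hn e e') (fun h => h.1.1)
      (HigherAngulated.isMaximalRigid_iff k hCY hT)
  · exact HigherAngulated.bijOn_isoClasses k hT hF (fun e h => h.of_iso e)
      (fun e e' h => h.of_equiv k hn e e') (fun h => h.1)
      (HigherAngulated.isSelfPerpendicular_iff k hCY hT)
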